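/- For $n\ge 4$ let $C_n$ be the cycle on $n$ vertices; a chord is an edge between two distinct vertices that are not consecutive on $C_n$. An instance of the cycle vertex-connectivity augmentation problem is a pair $(C_n,S)$ where $S$ is a set of chords (called links) such that the graph $C_n\cup S$ is $3$-vertex-connected; a feasible solution is a set $S'\subseteq S$ such that $C_n\cup S'$ is $3$-vertex-connected, and the goal is to find a feasible solution with the fewest links. Theorem. There is a polynomial-time $1.8704$-approximation algorithm for cycle vertex-connectivity augmentation: there are a single program $P$ (for a deterministic random access machine with addition, subtraction, comparison and indirect addressing at unit cost) and a polynomial $p$ such that, on every instance $(C_n,S)$, whatever the order in which the links are listed, $P$ halts after at most $p(n)$ steps and outputs a feasible solution $S'\subseteq S$ with $|S'|\le 1.8704\cdot|\mathrm{OPT}|$, where $\mathrm{OPT}$ is a feasible solution of minimum size. -/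

import Mathlib

/-! ### A random access machine with unit-cost step counting

Programs act on natural-number registers `reg 0, reg 1, …` and on infinite arrays
`arr 0, arr 1, …` of natural numbers.  The elementary operations are loading a constant, addition,
(truncated) subtraction, reading and writing an array cell at an address held in a register, and
comparing two registers.  Each elementary operation and each evaluation of a test takes one step.
There is no multiplication, so that in `t` steps a number can only grow by a factor `2 ^ O(t)`, and
running times agree with those of multi-tape Turing machines up to a polynomial. -/

namespace RAM

/-- The memory of the machine. -/
structure Memory where
  reg : ℕ → ℕ
  arr : ℕ → ℕ → ℕ

/-- `M.setReg x v`: register `x` is overwritten by `v`. -/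
def Memory.setReg (M : Memory) (x v : ℕ) : Memory :=
  { M with reg := Function.update M.reg x v }

/-- `M.setArr a i v`: the cell with index `i` of array `a` is overwritten by `v`. -/
def Memory.setArr (M : Memory) (a i v : ℕ) : Memory :=
  { M with arr := Function.update M.arr a (Function.update (M.arr a) i v) }

/-- Programs.  Registers and arrays are named by natural numbers; a program is a finite object and
names finitely many of them. -/
inductive Program where
  /-- do nothing -/
  | skip : Program
  /-- `reg x := c` -/
  | const (x c : ℕ) : Program
  /-- `reg x := reg y + reg z` -/
  | add (x y z : ℕ) : Program
  /-- `reg x := reg y - reg z` (truncated at `0`) -/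
  | sub (x y z : ℕ) : Program
  /-- `reg x := arr a [reg y]` -/
  | load (x a y : ℕ) : Program
  /-- `arr a [reg x] := reg y` -/
  | store (a x y : ℕ) : Program
  /-- first `p`, then `q` -/
  | seq (p q : Program) : Program
  /-- `if reg x < reg y then p else q` -/
  | ite (x y : ℕ) (p q : Program) : Program
  /-- `while reg x < reg y do p` -/
  | loop (x y : ℕ) (p : Program) : Program

/-- `Run p M M' t`: started with memory `M`, the program `p` halts after exactly `t` steps,
with memory `M'`. -/
inductive Run : Program → Memory → Memory → ℕ → Prop where
  | skip (M : Memory) : Run .skip M M 1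
  | const (x c : ℕ) (M : Memory) : Run (.const x c) M (M.setReg x c) 1
  | add (x y z : ℕ) (M : Memory) : Run (.add x y z) M (M.setReg x (M.reg y + M.reg z)) 1
  | sub (x y z : ℕ) (M : Memory) : Run (.sub x y z) M (M.setReg x (M.reg y - M.reg z)) 1
  | load (x a y : ℕ) (M : Memory) : Run (.load x a y) M (M.setReg x (M.arr a (M.reg y))) 1
  | store (a x y : ℕ) (M : Memory) : Run (.store a x y) M (M.setArr a (M.reg x) (M.reg y)) 1
  | seq {p q : Program} {M₀ M₁ M₂ : Memory} {t₁ t₂ : ℕ}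
      (hp : Run p M₀ M₁ t₁) (hq : Run q M₁ M₂ t₂) : Run (.seq p q) M₀ M₂ (t₁ + t₂)
  | ite_true {x y : ℕ} {p q : Program} {M M' : Memory} {t : ℕ}
      (hxy : M.reg x < M.reg y) (hp : Run p M M' t) : Run (.ite x y p q) M M' (t + 1)
  | ite_false {x y : ℕ} {p q : Program} {M M' : Memory} {t : ℕ}
      (hxy : ¬ M.reg x < M.reg y) (hq : Run q M M' t) : Run (.ite x y p q) M M' (t + 1)
  | loop_true {x y : ℕ} {p : Program} {M₀ M₁ M₂ : Memory} {t₁ t₂ : ℕ}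
      (hxy : M₀.reg x < M₀.reg y) (hp : Run p M₀ M₁ t₁) (hq : Run (.loop x y p) M₁ M₂ t₂) :
      Run (.loop x y p) M₀ M₂ (t₁ + t₂ + 1)
  | loop_false {x y : ℕ} {p : Program} {M : Memory}
      (hxy : ¬ M.reg x < M.reg y) : Run (.loop x y p) M M 1

/-- The machine is deterministic: a halting run determines the final memory and the number of
steps. -/
theorem Run.deterministic {p : Program} {M M₁ : Memory} {t₁ : ℕ} (h₁ : Run p M M₁ t₁) :
    ∀ {M₂ : Memory} {t₂ : ℕ}, Run p M M₂ t₂ → M₁ = M₂ ∧ t₁ = t₂ := by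
  induction h₁ with
  | skip | const | add | sub | load | store => intro _ _ h₂; cases h₂; exact ⟨rfl, rfl⟩
  | seq _ _ ihp ihq =>
    intro _ _ h₂
    cases h₂ with
    | seq hp hq =>
      obtain ⟨rfl, rfl⟩ := ihp hp
      obtain ⟨rfl, rfl⟩ := ihq hq
      exact ⟨rfl, rfl⟩
  | ite_true hxy _ ih =>
    intro _ _ h₂
    cases h₂ with
    | ite_true _ hp => obtain ⟨rfl, rfl⟩ := ih hp; exact ⟨rfl, rfl⟩
    | ite_false hn _ => exact absurd hxy hn
  | ite_false hxy _ ih =>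
    intro _ _ h₂
    cases h₂ with
    | ite_true hn _ => exact absurd hn hxy
    | ite_false _ hq => obtain ⟨rfl, rfl⟩ := ih hq; exact ⟨rfl, rfl⟩
  | loop_true hxy _ _ ihp ihq =>
    intro _ _ h₂
    cases h₂ with
    | loop_true _ hp hq =>
      obtain ⟨rfl, rfl⟩ := ihp hp
      obtain ⟨rfl, rfl⟩ := ihq hq
      exact ⟨rfl, rfl⟩
    | loop_false hn => exact absurd hxy hn
  | loop_false hxy =>
    intro _ _ h₂
    cases h₂ with
    | loop_true hn _ _ => exact absurd hn hxy
    | loop_false _ => exact ⟨rfl, rfl⟩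

end RAM

/-! ### Cycle vertex-connectivity augmentation -/

namespace CycleVCA

/-- `G` is `k`-vertex-connected: it has more than `k` vertices, and it stays connected after the
deletion of any set of at most `k - 1` vertices. -/
def IsVertexConnected {V : Type*} [Fintype V] (k : ℕ) (G : SimpleGraph V) : Prop :=
  k < Fintype.card V ∧ ∀ X : Finset V, X.card < k → (G.induce {v | v ∉ X}).Connected

/-- A chord of the cycle `C_n`: an edge between two distinct, non-consecutive vertices. -/
def IsChord (n : ℕ) (e : Sym2 (Fin n)) : Prop :=
  e ∈ ((SimpleGraph.cycleGraph n)ᶜ).edgeSet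

/-- The set of chords `L` `3`-connects the cycle: `C_n ∪ L` is `3`-vertex-connected. -/
def ThreeConnects (n : ℕ) (L : Finset (Sym2 (Fin n))) : Prop :=
  IsVertexConnected 3 (SimpleGraph.cycleGraph n ⊔ SimpleGraph.fromEdgeSet (L : Set (Sym2 (Fin n))))

/-- `(C_n, S)` is an instance: `n ≥ 4`, and `S` is a set of chords that `3`-connects the cycle. -/
structure IsInstance (n : ℕ) (S : Finset (Sym2 (Fin n))) : Prop where
  four_le : 4 ≤ n
  isChord : ∀ e ∈ S, IsChord n e
  threeConnects : ThreeConnects n S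

/-- `T` is a feasible solution of the instance `(C_n, S)`. -/
def IsFeasible (n : ℕ) (S T : Finset (Sym2 (Fin n))) : Prop :=
  T ⊆ S ∧ ThreeConnects n T

/-- The list `l` of pairs enumerates the set `S`: every element `s(a, b)` of `S` occurs exactly
once, as `(a, b)` or as `(b, a)`. -/
def Enumerates {n : ℕ} (l : List (Fin n × Fin n)) (S : Finset (Sym2 (Fin n))) : Prop :=
  (l.map fun c => s(c.1, c.2)).Nodup ∧ (l.map fun c => s(c.1, c.2)).toFinset = S

/-- The initial memory for the cycle on the vertices `0, …, n - 1` and the list `l` of links: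
`reg 0` holds `n`, `reg 1` holds the number of links, and `arr 0 [i]`, `arr 1 [i]` hold the two
endpoints of the `i`-th link.  All other registers and cells hold `0`. -/
def input (n : ℕ) (l : List (Fin n × Fin n)) : RAM.Memory where
  reg x := if x = 0 then n else if x = 1 then l.length else 0
  arr a i :=
    if h : i < l.length then
      if a = 0 then (l[i].1 : ℕ) else if a = 1 then (l[i].2 : ℕ) else 0
    else 0

/-- The set of links that the final memory `M` describes: the `i`-th link of `l` is selected if
`arr 2 [i]` holds a nonzero number. -/
def output {n : ℕ} (l : List (Fin n × Fin n)) (M : RAM.Memory) : Finset (Sym2 (Fin n)) :=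
  (Finset.univ.filter fun i : Fin l.length => M.arr 2 i ≠ 0).image
    fun i => s(l[i].1, l[i].2)

/-- `T` is a `ρ`-approximate solution of the instance `(C_n, S)`: it is feasible and at most `ρ`
times as large as any feasible solution. -/
def IsApproxSolution (ρ : ℝ) (n : ℕ) (S T : Finset (Sym2 (Fin n))) : Prop :=
  IsFeasible n S T ∧ ∀ T' : Finset (Sym2 (Fin n)), IsFeasible n S T' → (T.card : ℝ) ≤ ρ * T'.card

/-- The program `P` is a polynomial-time `ρ`-approximation algorithm for cycle vertex-connectivity
augmentation: there is a polynomial `p` such that on every instance `(C_n, S)`, in whatever order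
the links are listed, `P` halts within `p(n)` steps and leaves a `ρ`-approximate solution.
(As `S` has fewer than `n ^ 2` links, polynomial in `n` means polynomial in the input size.) -/
def IsPolyTimeApproximation (ρ : ℝ) (P : RAM.Program) : Prop :=
  ∃ p : Polynomial ℕ, ∀ (n : ℕ) (S : Finset (Sym2 (Fin n))) (l : List (Fin n × Fin n)),
    IsInstance n S → Enumerates l S →
      ∃ (M : RAM.Memory) (t : ℕ),
        RAM.Run P (input n l) M t ∧ t ≤ p.eval n ∧ IsApproxSolution ρ n S (output l M)

end CycleVCA

/-! A set of chords is feasible if and only if it crosses every cut, that is, every pair of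
non-consecutive vertices (`ThreeConnects.exists_interleave`, `threeConnects_of_interleave`).  If two
endpoints of a crossing-connected set of chords are separated by a pair of vertices, then some
chord of the set crosses this pair (`exists_cross_of_separates`).  Hence a feasible set is the same
as one with a crossing-connected part that reaches all vertices (`feasible_of_conn`,
`Feasible.grown`), and a feasible set has at least `n / 2` chords.

The algorithm has two phases.  For a set `F` of chords with `u` uncovered vertices and `c` crossing
components, the first phase, a local search, starts from a single chord and adds sets of at most
`80` chords to `F` as long as this decreases the potential `7 * |F| + 5 * u + 15 * c`.  The second
phase repeatedly adds a chord which crosses the component of the first chord and has an endpoint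
outside it.

The second phase adds at most `z = u + 3 * (c - 1)` chords.  Indeed, two sets of chords
which do not cross share at most two endpoints (`card_verts_inter_le_two`), so that a component of
`F` is absorbed at the latest when the growing component reaches three of its endpoints; each new
chord reaches an uncovered vertex or a further endpoint of a component that is not yet absorbed
(`Extends.defect_lt`).  When the phase stops, all vertices are reached
(`feasible_of_forall_not_extends`).

To bound `z` at a local optimum, let `T` be a feasible set with `q` chords.  As `T` is connected, it
is covered by `p + 1` connected pieces of at most `80` chords each, with `p ≤ q / 40` and total size
at most `q + p` (`Grown.exists_pieces`).  Adding a piece does not decrease the potential, so that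
five times the number of vertices it covers anew plus fifteen times the number of components it
merges, less one, is at most seven times its size.  Every uncovered vertex is covered by some piece,
and every component is crossed by some piece, so the sum over the pieces bounds `z` by about
`7 / 5 * q` (`IsLocalOpt.le_of_feasible`).  Together with `7 * |F| + 5 * z ≤ 5 * n ≤ 10 * q`, which
holds as the potential never exceeds its initial value, this gives a ratio below `1.87`
(`card_le_of_isLocalOpt`).

The program is written in a small language of arithmetic expressions with bounded sums and of
statements with bounded loops.  Its statements denote functions on memories, and they are compiled
to machine programs whose running time is bounded by a polynomial read off from the statement
(`Stmt.compile_runs`).  Termination is thus built in, and what remains to be shown is that the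
fixed numbers of passes suffice for the local search, the completion and the labelling of crossing
components to reach their fixed points (`iter_progress`, `iter_fixpoint`). -/

namespace CycleVCA
open Finset Relation

/-! ### Chords, cuts and crossings -/

/-- `x` lies strictly between `a` and `b`, in either order. -/
def Btw (a b x : ℕ) : Prop := (a < x ∧ x < b) ∨ (b < x ∧ x < a)

/-- `x` lies strictly outside the interval spanned by `a` and `b`. -/
def Outside (a b x : ℕ) : Prop := ¬ Btw a b x ∧ x ≠ a ∧ x ≠ b

/-- The pairs `{a, b}` and `{c, d}` interleave: as chords of the circle they cross. -/
def Interleave (a b c d : ℕ) : Prop :=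
  (Btw a b c ∧ Outside a b d) ∨ (Btw a b d ∧ Outside a b c)

theorem Interleave.symm {a b c d : ℕ} (h : Interleave a b c d) : Interleave c d a b := by
  unfold Interleave Outside Btw at *; omega

theorem Interleave.swap_left {a b c d : ℕ} (h : Interleave a b c d) : Interleave b a c d := by
  unfold Interleave Outside Btw at *; omega

theorem Interleave.swap_right {a b c d : ℕ} (h : Interleave a b c d) : Interleave a b d c := by
  unfold Interleave Outside Btw at *; omega

/-- `u < v` are non-consecutive on the cycle `0, …, n - 1`, so deleting them disconnects it. -/
def IsCut (n u v : ℕ) : Prop := u + 1 < v ∧ v < n ∧ ¬ (u = 0 ∧ v + 1 = n)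

/-- A list of `m` chords of the cycle `0, …, n - 1` which together cross every cut.  The `i`-th
chord, for `i < m`, joins `L i` and `R i`. -/
structure ChordSystem where
  n : ℕ
  m : ℕ
  L : ℕ → ℕ
  R : ℕ → ℕ
  four_le : 4 ≤ n
  chord : ∀ i < m, IsCut n (L i) (R i) ∨ IsCut n (R i) (L i)
  complete : ∀ u v, IsCut n u v → ∃ i < m, Interleave u v (L i) (R i)

namespace ChordSystem

variable (C : ChordSystem)

/-- The chords with indices `i` and `j` cross. -/
def Cross (i j : ℕ) : Prop := Interleave (C.L i) (C.R i) (C.L j) (C.R j)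

/-- `i` and `j` are joined by a sequence of crossing chords of `F`. -/
def Conn (F : Finset ℕ) (i j : ℕ) : Prop :=
  ReflTransGen (fun x y => x ∈ F ∧ y ∈ F ∧ C.Cross x y) i j

/-- The endpoints of the chords in `F`. -/
def verts (F : Finset ℕ) : Finset ℕ := F.image C.L ∪ F.image C.R

/-- `F` crosses every cut. -/
def Feasible (F : Finset ℕ) : Prop :=
  ∀ u v, IsCut C.n u v → ∃ i ∈ F, Interleave u v (C.L i) (C.R i)

variable {C}

theorem Cross.symm {i j : ℕ} (h : C.Cross i j) : C.Cross j i := Interleave.symm h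

theorem Conn.refl {F : Finset ℕ} (i : ℕ) : C.Conn F i i := ReflTransGen.refl

theorem Conn.trans {F : Finset ℕ} {i j k : ℕ} (h : C.Conn F i j) (h' : C.Conn F j k) :
    C.Conn F i k := ReflTransGen.trans h h'

theorem Conn.symm {F : Finset ℕ} {i j : ℕ} (h : C.Conn F i j) : C.Conn F j i := by
  induction h with
  | refl => exact Conn.refl _
  | tail _ h ih => exact ReflTransGen.head ⟨h.2.1, h.1, h.2.2.symm⟩ ih

theorem Conn.mono {F G : Finset ℕ} (hFG : F ⊆ G) {i j : ℕ} (h : C.Conn F i j) : C.Conn G i j :=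
  ReflTransGen.mono (fun _ _ h => ⟨hFG h.1, hFG h.2.1, h.2.2⟩) _ _ h

theorem Conn.of_cross {F : Finset ℕ} {i j : ℕ} (hi : i ∈ F) (hj : j ∈ F) (h : C.Cross i j) :
    C.Conn F i j := ReflTransGen.single ⟨hi, hj, h⟩

theorem Conn.mem {F : Finset ℕ} {i j : ℕ} (h : C.Conn F i j) (hi : i ∈ F) : j ∈ F := by
  induction h with
  | refl => exact hi
  | tail _ h _ => exact h.2.1

theorem mem_verts {F : Finset ℕ} {v : ℕ} : v ∈ C.verts F ↔ ∃ i ∈ F, C.L i = v ∨ C.R i = v := by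
  simp only [verts, mem_union, mem_image]
  constructor
  · rintro (⟨i, hi, h⟩ | ⟨i, hi, h⟩)
    · exact ⟨i, hi, Or.inl h⟩
    · exact ⟨i, hi, Or.inr h⟩
  · rintro ⟨i, hi, h | h⟩
    · exact Or.inl ⟨i, hi, h⟩
    · exact Or.inr ⟨i, hi, h⟩

theorem verts_mono {F G : Finset ℕ} (h : F ⊆ G) : C.verts F ⊆ C.verts G := by
  intro v hv
  obtain ⟨i, hi, hv⟩ := mem_verts.1 hv
  exact mem_verts.2 ⟨i, h hi, hv⟩

theorem verts_union (F G : Finset ℕ) : C.verts (F ∪ G) = C.verts F ∪ C.verts G := by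
  simp only [verts, image_union]
  exact union_union_union_comm _ _ _ _

theorem lt_of_mem_verts {F : Finset ℕ} (hF : F ⊆ range C.m) {v : ℕ} (hv : v ∈ C.verts F) :
    v < C.n := by
  obtain ⟨i, hi, hv⟩ := mem_verts.1 hv
  have := C.chord i (mem_range.1 (hF hi))
  unfold IsCut at this
  omega

theorem card_verts_le (F : Finset ℕ) : (C.verts F).card ≤ 2 * F.card := by
  have h1 := card_union_le (F.image C.L) (F.image C.R)
  have h2 := card_image_le (s := F) (f := C.L)
  have h3 := card_image_le (s := F) (f := C.R)
  unfold verts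
  omega

/-- If no chord reachable from `i` crosses `{p, q}`, then none of them leaves the closed interval
spanned by `p` and `q`, as two crossing chords cannot lie on different sides of `{p, q}`. -/
theorem exists_cross_inside {F : Finset ℕ} {p q i j x y : ℕ} (hc : C.Conn F i j)
    (hx : C.L i = x ∨ C.R i = x) (hy : C.L j = y ∨ C.R j = y)
    (hpx : Btw p q x) (hpy : Outside p q y) :
    ∃ l, C.Conn F i l ∧ Interleave p q (C.L l) (C.R l) := by
  by_contra! hno
  have key : ∀ l, C.Conn F i l → ¬ Outside p q (C.L l) ∧ ¬ Outside p q (C.R l) := by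
    intro l hl
    induction hl with
    | refl =>
      have := hno i (Conn.refl i)
      unfold Interleave Outside Btw at *
      rcases hx with rfl | rfl <;> omega
    | @tail l l' hl hll ih =>
      have h1 := hno l' (ReflTransGen.tail hl hll)
      have h2 : Interleave _ _ _ _ := hll.2.2
      unfold Interleave Outside Btw at *
      omega
  have := key j hc
  rcases hy with rfl | rfl
  · exact this.1 hpy
  · exact this.2 hpy

/-- A chord (or cut) `{p, q}` which separates two endpoints `x`, `y` of a crossing-connected set of
chords crosses one of these chords. -/
theorem exists_cross_of_separates {F : Finset ℕ} {p q i j x y : ℕ} (hc : C.Conn F i j)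
    (hx : C.L i = x ∨ C.R i = x) (hy : C.L j = y ∨ C.R j = y) (hs : Interleave p q x y) :
    ∃ l, C.Conn F i l ∧ Interleave p q (C.L l) (C.R l) := by
  rcases hs with ⟨h1, h2⟩ | ⟨h1, h2⟩
  · exact exists_cross_inside hc hx hy h1 h2
  · obtain ⟨l, hl, h⟩ := exists_cross_inside hc.symm hy hx h1 h2
    exact ⟨l, hc.trans hl, h⟩

/-- If the endpoints of a set of chords miss a vertex, two of them which are neighbours around the
gap form a cut, and whatever crosses this cut has an endpoint in the gap. -/
theorem exists_gap {F : Finset ℕ} (hF : F ⊆ range C.m) (hne : F.Nonempty) {w : ℕ} (hw : w < C.n)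
    (hwF : w ∉ C.verts F) :
    ∃ u ∈ C.verts F, ∃ v ∈ C.verts F, IsCut C.n u v ∧
      ∀ c d, Interleave u v c d → c ∉ C.verts F ∨ d ∉ C.verts F := by
  obtain ⟨i, hi⟩ := hne
  have hiL : C.L i ∈ C.verts F := mem_verts.2 ⟨i, hi, Or.inl rfl⟩
  have hiR : C.R i ∈ C.verts F := mem_verts.2 ⟨i, hi, Or.inr rfl⟩
  have hch := C.chord i (mem_range.1 (hF hi))
  by_cases hlo : ∃ u ∈ C.verts F, u < w
  · by_cases hhi : ∃ v ∈ C.verts F, w < v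
    · have h1 : ((C.verts F).filter (· < w)).Nonempty := by
        obtain ⟨u, hu, h⟩ := hlo; exact ⟨u, mem_filter.2 ⟨hu, h⟩⟩
      have h2 : ((C.verts F).filter (w < ·)).Nonempty := by
        obtain ⟨u, hu, h⟩ := hhi; exact ⟨u, mem_filter.2 ⟨hu, h⟩⟩
      have hu := max'_mem _ h1
      have hv := min'_mem _ h2
      have hmax : ∀ x ∈ C.verts F, x < w → x ≤ max' _ h1 :=
        fun x hx hxw => le_max' _ _ (mem_filter.2 ⟨hx, hxw⟩)
      have hmin : ∀ x ∈ C.verts F, w < x → min' _ h2 ≤ x :=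
        fun x hx hxw => min'_le _ _ (mem_filter.2 ⟨hx, hxw⟩)
      generalize max' _ h1 = u at hu hmax
      generalize min' _ h2 = v at hv hmin
      rw [mem_filter] at hu hv
      have hvn := lt_of_mem_verts hF hv.1
      have hnot : ∀ x ∈ C.verts F, ¬ Btw u v x := by
        intro x hx hb
        have h3 := hmax x hx
        have h4 := hmin x hx
        have h5 : x ≠ w := fun h => hwF (h ▸ hx)
        unfold Btw at hb
        omega
      refine ⟨u, hu.1, v, hv.1, ?_, ?_⟩
      · have h3 := hnot _ hiL
        have h4 := hnot _ hiR
        unfold IsCut Btw at *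
        omega
      · rintro c d (h | h)
        · exact Or.inl fun hc => hnot c hc h.1
        · exact Or.inr fun hc => hnot d hc h.1
    · push Not at hhi
      have hne : (C.verts F).Nonempty := ⟨_, hiL⟩
      have hu := min'_mem _ hne
      have hv := max'_mem _ hne
      have hmin : ∀ x ∈ C.verts F, min' _ hne ≤ x := fun x hx => min'_le _ _ hx
      have hmax : ∀ x ∈ C.verts F, x ≤ max' _ hne := fun x hx => le_max' _ _ hx
      generalize min' _ hne = u at hu hmin
      generalize max' _ hne = v at hv hmax
      have h1 := hmin _ hiL
      have h2 := hmin _ hiR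
      have h3 := hmax _ hiL
      have h4 := hmax _ hiR
      have h5 := hhi v hv
      have h6 : v ≠ w := fun h => hwF (h ▸ hv)
      refine ⟨u, hu, v, hv, ?_, ?_⟩
      · unfold IsCut at *; omega
      · rintro c d (h | h)
        · refine Or.inr fun hd => ?_
          have := hmin d hd; have := hmax d hd
          unfold Outside Btw at h; omega
        · refine Or.inl fun hd => ?_
          have := hmin c hd; have := hmax c hd
          unfold Outside Btw at h; omega
  · push Not at hlo
    have hne : (C.verts F).Nonempty := ⟨_, hiL⟩
    have hu := min'_mem _ hne
    have hv := max'_mem _ hne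
    have hmin : ∀ x ∈ C.verts F, min' _ hne ≤ x := fun x hx => min'_le _ _ hx
    have hmax : ∀ x ∈ C.verts F, x ≤ max' _ hne := fun x hx => le_max' _ _ hx
    generalize min' _ hne = u at hu hmin
    generalize max' _ hne = v at hv hmax
    have h1 := hmin _ hiL
    have h2 := hmin _ hiR
    have h3 := hmax _ hiL
    have h4 := hmax _ hiR
    have h5 := hlo u hu
    have h6 : u ≠ w := fun h => hwF (h ▸ hu)
    have h7 := lt_of_mem_verts hF hv
    refine ⟨u, hu, v, hv, ?_, ?_⟩
    · unfold IsCut at *; omega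
    · rintro c d (h | h)
      · refine Or.inr fun hd => ?_
        have := hmin d hd; have := hmax d hd
        unfold Outside Btw at h; omega
      · refine Or.inl fun hd => ?_
        have := hmin c hd; have := hmax c hd
        unfold Outside Btw at h; omega

/-- Every vertex is an endpoint of a feasible set of chords: its two neighbours form a cut. -/
theorem Feasible.mem_verts {T : Finset ℕ} (hT : C.Feasible T) (hTm : T ⊆ range C.m) {v : ℕ}
    (hv : v < C.n) : v ∈ C.verts T := by
  have h4 := C.four_le
  have : ∃ u w, IsCut C.n u w ∧
      ∀ c d, Interleave u w c d → c < C.n → d < C.n → c = v ∨ d = v := by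
    unfold IsCut Interleave Outside Btw
    rcases Nat.eq_zero_or_pos v with h0 | h0
    · exact ⟨1, C.n - 1, by omega, by omega⟩
    · rcases Nat.lt_or_ge (v + 1) C.n with h1 | h1
      · exact ⟨v - 1, v + 1, by omega, by omega⟩
      · exact ⟨0, v - 1, by omega, by omega⟩
  obtain ⟨u, w, hcut, h⟩ := this
  obtain ⟨i, hi, hI⟩ := hT u w hcut
  exact ChordSystem.mem_verts.2 ⟨i, hi, h _ _ hI
    (lt_of_mem_verts hTm (ChordSystem.mem_verts.2 ⟨i, hi, Or.inl rfl⟩))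
    (lt_of_mem_verts hTm (ChordSystem.mem_verts.2 ⟨i, hi, Or.inr rfl⟩))⟩

/-- The first lower bound for the optimum. -/
theorem Feasible.le_two_mul_card {T : Finset ℕ} (hT : C.Feasible T) (hTm : T ⊆ range C.m) :
    C.n ≤ 2 * T.card := by
  have h : range C.n ⊆ C.verts T := fun v hv => hT.mem_verts hTm (mem_range.1 hv)
  have := card_le_card h
  rw [card_range] at this
  exact this.trans (card_verts_le T)

/-- A crossing-connected part of `F` which reaches all vertices makes `F` feasible. -/
theorem feasible_of_conn {F : Finset ℕ} {r : ℕ} (hr : r ∈ F)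
    (h : ∀ v < C.n, ∃ i, C.Conn F r i ∧ (C.L i = v ∨ C.R i = v)) : C.Feasible F := by
  intro u v huv
  have : ∃ x y, x < C.n ∧ y < C.n ∧ Interleave u v x y := by
    unfold IsCut at huv
    unfold Interleave Outside Btw
    rcases Nat.eq_zero_or_pos u with h0 | h0
    · exact ⟨u + 1, v + 1, by omega, by omega, by omega⟩
    · exact ⟨u + 1, 0, by omega, by omega, by omega⟩
  obtain ⟨x, y, hx, hy, hI⟩ := this
  obtain ⟨i, hi, hix⟩ := h x hx
  obtain ⟨j, hj, hjy⟩ := h y hy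
  obtain ⟨l, hl, hlI⟩ := exists_cross_of_separates (hi.symm.trans hj) hix hjy hI
  exact ⟨l, (hi.trans hl).mem hr, hlI⟩

/-- A set of chords that can be built up from a single chord by adding, one at a time, chords which
cross an earlier one. -/
inductive Grown (C : ChordSystem) : Finset ℕ → Prop
  | single (i : ℕ) : Grown C {i}
  | insert {F : Finset ℕ} {i j : ℕ} (hF : Grown C F) (hi : i ∈ F) (hj : j ∉ F) (h : C.Cross i j) :
      Grown C (insert j F)

theorem Grown.conn {F : Finset ℕ} (h : C.Grown F) : ∀ i ∈ F, ∀ j ∈ F, C.Conn F i j := by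
  induction h with
  | single k =>
    intro i hi j hj
    rw [mem_singleton] at hi hj
    subst hi hj
    exact Conn.refl _
  | @insert F k l _ hk _ hkl ih =>
    have h1 : ∀ i ∈ Insert.insert l F, C.Conn (Insert.insert l F) k i := by
      intro i hi
      rcases mem_insert.1 hi with rfl | hi
      · exact Conn.of_cross (mem_insert_of_mem hk) (mem_insert_self _ _) hkl
      · exact (ih k hk i hi).mono (subset_insert _ _)
    intro i hi j hj
    exact (h1 i hi).symm.trans (h1 j hj)

theorem Grown.nonempty {F : Finset ℕ} (h : C.Grown F) : F.Nonempty := by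
  cases h with
  | single k => exact singleton_nonempty k
  | insert _ _ _ _ => exact insert_nonempty _ _

/-- A feasible set is connected through crossings: a maximal connected part of it misses no vertex,
since the cut next to a missed vertex would be crossed by a further chord of the set; such a part
crosses every cut, and hence every chord of the set. -/
theorem Feasible.grown {T : Finset ℕ} (hT : C.Feasible T) (hTm : T ⊆ range C.m) : C.Grown T := by
  classical
  have hTne : T.Nonempty := by
    have := hT.le_two_mul_card hTm
    have := C.four_le
    exact card_pos.1 (by omega)
  obtain ⟨i₀, hi₀⟩ := hTne
  obtain ⟨M, hM, hmax⟩ := exists_max_image (T.powerset.filter C.Grown) card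
    ⟨{i₀}, mem_filter.2 ⟨mem_powerset.2 (singleton_subset_iff.2 hi₀), Grown.single _⟩⟩
  rw [mem_filter, mem_powerset] at hM
  obtain ⟨hMT, hMg⟩ := hM
  have hno : ∀ i ∈ M, ∀ j ∈ T, C.Cross i j → j ∈ M := by
    intro i hi j hj hij
    by_contra hjM
    have := hmax (insert j M)
      (mem_filter.2 ⟨mem_powerset.2 (insert_subset hj hMT), hMg.insert hi hjM hij⟩)
    rw [card_insert_of_notMem hjM] at this
    omega
  have hverts : ∀ v < C.n, v ∈ C.verts M := by
    by_contra! hv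
    obtain ⟨w, hw, hwM⟩ := hv
    obtain ⟨u, hu, v, hv, hcut, hgap⟩ := exists_gap (hMT.trans hTm) hMg.nonempty hw hwM
    obtain ⟨e, he, heI⟩ := hT u v hcut
    obtain ⟨i, hi, hiu⟩ := ChordSystem.mem_verts.1 hu
    obtain ⟨j, hj, hjv⟩ := ChordSystem.mem_verts.1 hv
    obtain ⟨l, hl, hlI⟩ := exists_cross_of_separates (hMg.conn i hi j hj) hiu hjv heI.symm
    have heM : e ∈ M := hno l (hl.mem hi) e he hlI.symm
    rcases hgap _ _ heI with h | h
    · exact h (ChordSystem.mem_verts.2 ⟨e, heM, Or.inl rfl⟩)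
    · exact h (ChordSystem.mem_verts.2 ⟨e, heM, Or.inr rfl⟩)
  have hMfeas : C.Feasible M := by
    obtain ⟨r, hr⟩ := hMg.nonempty
    refine feasible_of_conn hr fun v hv => ?_
    obtain ⟨i, hi, h⟩ := ChordSystem.mem_verts.1 (hverts v hv)
    exact ⟨i, hMg.conn r hr i hi, h⟩
  have : M = T := by
    refine Subset.antisymm hMT fun j hj => ?_
    obtain ⟨l, hl, hlI⟩ : ∃ l ∈ M, Interleave (C.L j) (C.R j) (C.L l) (C.R l) := by
      rcases C.chord j (mem_range.1 (hTm hj)) with h | h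
      · exact hMfeas _ _ h
      · obtain ⟨l, hl, h⟩ := hMfeas _ _ h
        exact ⟨l, hl, h.swap_left⟩
    exact hno l hl j hj hlI.symm
  exact this ▸ hMg

/-! ### Crossing components -/

open Classical in
/-- The crossing component of `i` in the set of chords `F`. -/
noncomputable def comp (C : ChordSystem) (F : Finset ℕ) (i : ℕ) : Finset ℕ :=
  F.filter (C.Conn F i)

/-- The number of crossing components of `F`. -/
noncomputable def numComp (C : ChordSystem) (F : Finset ℕ) : ℕ := (F.image (C.comp F)).card

/-- The vertices which are not endpoints of a chord in `F`. -/
def uncovered (C : ChordSystem) (F : Finset ℕ) : Finset ℕ := range C.n \ C.verts F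

/-- The set `A` is nonempty and connected through crossings. -/
def IsConn (C : ChordSystem) (A : Finset ℕ) : Prop :=
  A.Nonempty ∧ ∀ i ∈ A, ∀ j ∈ A, C.Conn A i j

theorem mem_comp {F : Finset ℕ} {i j : ℕ} : j ∈ C.comp F i ↔ j ∈ F ∧ C.Conn F i j := by
  simp [comp]

theorem comp_eq_iff {F : Finset ℕ} {i j : ℕ} (hj : j ∈ F) :
    C.comp F i = C.comp F j ↔ C.Conn F i j := by
  constructor
  · intro h
    have : j ∈ C.comp F i := h ▸ mem_comp.2 ⟨hj, Conn.refl j⟩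
    exact (mem_comp.1 this).2
  · intro h
    ext l
    rw [mem_comp, mem_comp]
    exact ⟨fun hl => ⟨hl.1, h.symm.trans hl.2⟩, fun hl => ⟨hl.1, h.trans hl.2⟩⟩

/-! ### Covering a connected set by small connected pieces -/

theorem IsConn.union {A B : Finset ℕ} (hA : C.IsConn A) (hB : C.IsConn B) {i j : ℕ} (hi : i ∈ A)
    (hj : j ∈ B) (h : C.Cross i j) : C.IsConn (A ∪ B) := by
  refine ⟨hA.1.mono subset_union_left, ?_⟩
  have h1 : ∀ k ∈ A ∪ B, C.Conn (A ∪ B) i k := by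
    intro k hk
    rcases mem_union.1 hk with hk | hk
    · exact (hA.2 i hi k hk).mono subset_union_left
    · exact (Conn.of_cross (mem_union_left _ hi) (mem_union_right _ hj) h).trans
        ((hB.2 j hj k hk).mono subset_union_right)
  exact fun k hk l hl => (h1 k hk).symm.trans (h1 l hl)

/-- The leaves of a spanning tree are merged into their neighbours one after the other; a cluster
is split off as soon as it has more than `s` elements, and leaves behind the chord to which it is
attached.  Here `R x` is the cluster which has been merged into `x`. -/
theorem Grown.exists_pieces_aux {s : ℕ} (hs : 1 ≤ s) {T Z : Finset ℕ} (hT : C.Grown T) :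
    ∀ R : ℕ → Finset ℕ,
      (∀ x ∈ T, x ∈ R x ∧ C.IsConn (R x) ∧ (R x).card ≤ s ∧ R x ⊆ Z) →
      ∃ (P : List (Finset ℕ)) (p : ℕ), P.length = p + 1 ∧
        (∀ A ∈ P, C.IsConn A ∧ A.card ≤ 2 * s ∧ A ⊆ Z) ∧
        (∀ x ∈ T, ∀ y ∈ R x, ∃ A ∈ P, y ∈ A) ∧
        (P.map card).sum ≤ ∑ x ∈ T, (R x).card + p ∧
        s * p + 1 ≤ ∑ x ∈ T, (R x).card := by
  induction hT with
  | single k =>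
    intro R hR
    obtain ⟨h1, h2, h3, h4⟩ := hR k (mem_singleton_self k)
    refine ⟨[R k], 0, rfl, ?_, ?_, ?_, ?_⟩
    · intro A hA
      rw [List.mem_singleton] at hA
      subst hA
      exact ⟨h2, by omega, h4⟩
    · intro x hx y hy
      rw [mem_singleton] at hx
      subst hx
      exact ⟨R x, List.mem_singleton.2 rfl, hy⟩
    · simp
    · have := card_pos.2 ⟨k, h1⟩
      simpa using this
  | @insert F i j hF hi hj h ih =>
    intro R hR
    obtain ⟨i1, i2, i3, i4⟩ := hR i (mem_insert_of_mem hi)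
    obtain ⟨j1, j2, j3, j4⟩ := hR j (mem_insert_self _ _)
    have hconn := i2.union j2 i1 j1 h
    have hle := card_union_le (R i) (R j)
    have hsum : ∀ Q : Finset ℕ, ∑ x ∈ F, (Function.update R i Q x).card + (R i).card
        = ∑ x ∈ F, (R x).card + Q.card := by
      intro Q
      rw [← add_sum_erase _ _ hi, ← add_sum_erase F (fun x => (R x).card) hi,
        Function.update_self]
      have : ∑ x ∈ F.erase i, (Function.update R i Q x).card = ∑ x ∈ F.erase i, (R x).card :=
        sum_congr rfl fun x hx => by rw [Function.update_of_ne (ne_of_mem_erase hx)]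
      rw [this]
      ring
    rw [sum_insert hj]
    have hupd : ∀ Q : Finset ℕ, i ∈ Q → C.IsConn Q → Q.card ≤ s → Q ⊆ Z →
        ∀ x ∈ F, x ∈ Function.update R i Q x ∧ C.IsConn (Function.update R i Q x) ∧
          (Function.update R i Q x).card ≤ s ∧ Function.update R i Q x ⊆ Z := by
      intro Q q1 q2 q3 q4 x hx
      by_cases hxi : x = i
      · subst hxi
        rw [Function.update_self]
        exact ⟨q1, q2, q3, q4⟩
      · rw [Function.update_of_ne hxi]
        exact hR x (mem_insert_of_mem hx)
    by_cases hcard : (R i ∪ R j).card ≤ s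
    · obtain ⟨P, p, hp, h1, h2, h3, h4⟩ := ih (Function.update R i (R i ∪ R j))
        (hupd _ (mem_union_left _ i1) hconn hcard (union_subset i4 j4))
      have := hsum (R i ∪ R j)
      refine ⟨P, p, hp, h1, ?_, by omega, by omega⟩
      intro x hx y hy
      have key : ∀ y ∈ R i ∪ R j, ∃ A ∈ P, y ∈ A := fun y hy =>
        h2 i hi y (by rwa [Function.update_self])
      rcases mem_insert.1 hx with rfl | hx
      · exact key y (mem_union_right _ hy)
      · by_cases hxi : x = i
        · subst hxi
          exact key y (mem_union_left _ hy)
        · exact h2 x hx y (by rwa [Function.update_of_ne hxi])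
    · obtain ⟨P, p, hp, h1, h2, h3, h4⟩ := ih (Function.update R i {i})
        (hupd _ (mem_singleton_self i) ⟨singleton_nonempty i, fun a ha b hb => by
          rw [mem_singleton] at ha hb
          subst ha hb
          exact Conn.refl _⟩ (by simpa using hs) (singleton_subset_iff.2 (i4 i1)))
      have := hsum {i}
      rw [card_singleton] at this
      refine ⟨(R i ∪ R j) :: P, p + 1, by simp [hp], ?_, ?_, ?_, ?_⟩
      · intro A hA
        rcases List.mem_cons.1 hA with rfl | hA
        · exact ⟨hconn, by omega, union_subset i4 j4⟩
        · exact h1 A hA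
      · intro x hx y hy
        rcases mem_insert.1 hx with rfl | hx
        · exact ⟨_, List.mem_cons_self, mem_union_right _ hy⟩
        · by_cases hxi : x = i
          · subst hxi
            exact ⟨_, List.mem_cons_self, mem_union_left _ hy⟩
          · obtain ⟨A, hA, hyA⟩ := h2 x hx y (by rwa [Function.update_of_ne hxi])
            exact ⟨A, List.mem_cons_of_mem _ hA, hyA⟩
      · rw [List.map_cons, List.sum_cons]
        omega
      · rw [Nat.mul_add]
        omega

/-- A connected set `T` is covered by `p + 1` connected sets of at most `2 * s` elements, where
`p ≤ |T| / s` and the sizes add up to at most `|T| + p`. -/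
theorem Grown.exists_pieces {s : ℕ} (hs : 1 ≤ s) {T : Finset ℕ} (hT : C.Grown T) :
    ∃ (P : List (Finset ℕ)) (p : ℕ), P.length = p + 1 ∧
      (∀ A ∈ P, C.IsConn A ∧ A.card ≤ 2 * s ∧ A ⊆ T) ∧ (∀ x ∈ T, ∃ A ∈ P, x ∈ A) ∧
      (P.map card).sum ≤ T.card + p ∧ s * p + 1 ≤ T.card := by
  obtain ⟨P, p, h0, h1, h2, h3, h4⟩ := hT.exists_pieces_aux hs (Z := T) (fun x => {x}) (by
    intro x hx
    refine ⟨mem_singleton_self x, ⟨singleton_nonempty x, fun a ha b hb => ?_⟩, by simpa using hs,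
      singleton_subset_iff.2 hx⟩
    rw [mem_singleton] at ha hb
    subst ha hb
    exact Conn.refl _)
  refine ⟨P, p, h0, h1, fun x hx => h2 x hx x (mem_singleton_self x), by simpa using h3,
    by simpa using h4⟩

/-! ### Locally optimal sets of chords -/

/-- The crossing components of `F` which meet or cross `A`. -/
noncomputable def touched (C : ChordSystem) (F A : Finset ℕ) : Finset (Finset ℕ) :=
  open Classical in
  (F.image (C.comp F)).filter fun K => ∃ i ∈ K, ∃ j ∈ A, i = j ∨ C.Cross i j

/-- Adding a connected set of chords merges all the components which it touches. -/
theorem numComp_union_add_touched {F A : Finset ℕ} (hA : C.IsConn A) :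
    C.numComp (F ∪ A) + (C.touched F A).card ≤ C.numComp F + 1 := by
  classical
  obtain ⟨a, ha⟩ := hA.1
  let g : Finset ℕ → Finset ℕ := fun K =>
    (F ∪ A).filter fun j => ∃ i ∈ K, C.Conn (F ∪ A) i j
  have hg : ∀ i ∈ F, g (C.comp F i) = C.comp (F ∪ A) i := by
    intro i hi
    ext j
    simp only [g, mem_filter, mem_comp]
    constructor
    · rintro ⟨hj, k, ⟨_, hk⟩, hkj⟩
      exact ⟨hj, (hk.mono subset_union_left).trans hkj⟩
    · rintro ⟨hj, hij⟩
      exact ⟨hj, i, ⟨hi, Conn.refl i⟩, hij⟩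
  have hsub : (F ∪ A).image (C.comp (F ∪ A)) ⊆
      insert (C.comp (F ∪ A) a) ((F.image (C.comp F) \ C.touched F A).image g) := by
    intro K hK
    obtain ⟨i, hi, rfl⟩ := mem_image.1 hK
    by_cases hia : C.Conn (F ∪ A) i a
    · exact mem_insert.2 (Or.inl ((comp_eq_iff (mem_union_right _ ha)).2 hia))
    · have hiF : i ∈ F := by
        rcases mem_union.1 hi with h | h
        · exact h
        · exact absurd ((hA.2 i h a ha).mono subset_union_right) hia
      refine mem_insert_of_mem (mem_image.2 ⟨C.comp F i, mem_sdiff.2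
        ⟨mem_image_of_mem _ hiF, ?_⟩, hg i hiF⟩)
      intro ht
      obtain ⟨-, k, hk, j, hj, hkj⟩ := mem_filter.1 ht
      rw [mem_comp] at hk
      refine hia ((hk.2.mono subset_union_left).trans ?_)
      have hja := (hA.2 j hj a ha).mono (G := F ∪ A) subset_union_right
      rcases hkj with rfl | hkj
      · exact hja
      · exact (Conn.of_cross (mem_union_left _ hk.1) (mem_union_right _ hj) hkj).trans hja
  have h1 := (card_le_card hsub).trans (card_insert_le _ _)
  have h2 := card_image_le (s := F.image (C.comp F) \ C.touched F A) (f := g)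
  have h3 : (F.image (C.comp F) \ C.touched F A).card + (C.touched F A).card
      = (F.image (C.comp F)).card := card_sdiff_add_card_eq_card (filter_subset _ _)
  unfold numComp
  omega

/-- The potential which the local search decreases.  The completion of `F` costs at most
`u + 3 * c - 3` chords, where `u` is the number of uncovered vertices and `c` that of components;
hence the weights `5` and `15`.  The weight `7` of a selected chord trades the cost of `F` against
that of the completion: with weight `w` in units of the cost of the completion, the ratio tends to
`2 / w + w - 1` as larger sets are tried, which is smallest at `√2`, close to `7 / 5`. -/
noncomputable def potential (C : ChordSystem) (F : Finset ℕ) : ℕ :=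
  7 * F.card + 5 * (C.uncovered F).card + 15 * C.numComp F

/-- No set of at most `k` chords can be added to `F` so that the potential decreases. -/
def IsLocalOpt (C : ChordSystem) (k : ℕ) (F : Finset ℕ) : Prop :=
  ∀ A ⊆ range C.m, A.Nonempty → A.card ≤ k → C.potential F ≤ C.potential (F ∪ A)

/-- A connected set `A` which is not worth adding covers few new vertices and touches few
components of `F`. -/
theorem IsLocalOpt.le_of_isConn {k : ℕ} {F A : Finset ℕ} (hF : C.IsLocalOpt k F)
    (hA : C.IsConn A) (hAm : A ⊆ range C.m) (hk : A.card ≤ k) :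
    5 * ((C.uncovered F).filter (· ∈ C.verts A)).card + 15 * (C.touched F A).card
      ≤ 7 * A.card + 15 := by
  have h1 := hF A hAm hA.1 hk
  have h2 := numComp_union_add_touched (F := F) hA
  have h3 := card_union_le F A
  have h4 : ((C.uncovered F).filter (· ∈ C.verts A)).card + (C.uncovered (F ∪ A)).card
      = (C.uncovered F).card := by
    rw [← card_filter_add_card_filter_not (s := C.uncovered F) (· ∈ C.verts A)]
    congr 2
    ext v
    simp only [uncovered, verts_union, mem_sdiff, mem_union, mem_filter]
    tauto
  unfold potential at h1
  omega

/-- If every element of `X` is related to a member of `P`, then `|X|` is at most the sum of the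
numbers of elements related to each member. -/
theorem card_le_sum_filter {α β : Type*} (X : Finset α) (P : List β) (rel : β → α → Prop)
    [∀ b, DecidablePred (rel b)] (h : ∀ x ∈ X, ∃ b ∈ P, rel b x) :
    X.card ≤ (P.map fun b => (X.filter (rel b)).card).sum := by
  classical
  induction P generalizing X with
  | nil =>
    have : X = ∅ := eq_empty_of_forall_notMem fun x hx => by
      obtain ⟨b, hb, -⟩ := h x hx
      exact List.not_mem_nil hb
    simp [this]
  | cons b P ih =>
    rw [List.map_cons, List.sum_cons, ← card_filter_add_card_filter_not (s := X) (rel b)]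
    refine Nat.add_le_add_left ((ih (X.filter fun x => ¬ rel b x) ?_).trans
      (List.sum_le_sum fun c _ => card_le_card (filter_subset_filter _ (filter_subset _ _)))) _
    intro x hx
    obtain ⟨hx, hb⟩ := mem_filter.1 hx
    obtain ⟨c, hc, hcx⟩ := h x hx
    rcases List.mem_cons.1 hc with rfl | hc
    · exact absurd hcx hb
    · exact ⟨c, hc, hcx⟩

/-- A locally optimal set can be completed cheaply compared with any feasible set `T`.  The
inequality is the sum of those which local optimality gives for the pieces of `T`. -/
theorem IsLocalOpt.le_of_feasible {s : ℕ} (hs : 1 ≤ s) {F T : Finset ℕ}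
    (hF : C.IsLocalOpt (2 * s) F) (hFm : F ⊆ range C.m) (hT : C.Feasible T)
    (hTm : T ⊆ range C.m) :
    ∃ p, s * p + 1 ≤ T.card ∧
      5 * (C.uncovered F).card + 15 * C.numComp F ≤ 7 * T.card + 22 * p + 15 := by
  classical
  obtain ⟨P, p, hp, h1, h2, h3, h4⟩ := (hT.grown hTm).exists_pieces hs
  refine ⟨p, h4, ?_⟩
  have hU : (C.uncovered F).card ≤
      (P.map fun A => ((C.uncovered F).filter (· ∈ C.verts A)).card).sum := by
    refine card_le_sum_filter _ _ (fun A v => v ∈ C.verts A) fun v hv => ?_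
    obtain ⟨i, hi, hiv⟩ := ChordSystem.mem_verts.1
      (hT.mem_verts hTm (mem_range.1 (mem_sdiff.1 hv).1))
    obtain ⟨A, hA, hiA⟩ := h2 i hi
    exact ⟨A, hA, ChordSystem.mem_verts.2 ⟨i, hiA, hiv⟩⟩
  have hc : C.numComp F ≤ (P.map fun A => (C.touched F A).card).sum := by
    refine card_le_sum_filter _ _
      (fun A K => ∃ i ∈ K, ∃ j ∈ A, i = j ∨ C.Cross i j) fun K hK => ?_
    obtain ⟨i, hi, rfl⟩ := mem_image.1 hK
    obtain ⟨l, hl, hlI⟩ : ∃ l ∈ T, Interleave (C.L i) (C.R i) (C.L l) (C.R l) := by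
      rcases C.chord i (mem_range.1 (hFm hi)) with h | h
      · exact hT _ _ h
      · obtain ⟨l, hl, h⟩ := hT _ _ h
        exact ⟨l, hl, h.swap_left⟩
    obtain ⟨A, hA, hlA⟩ := h2 l hl
    exact ⟨A, hA, i, mem_comp.2 ⟨hi, Conn.refl i⟩, l, hlA, Or.inr hlI⟩
  have hsum : ∀ Q : List (Finset ℕ), (∀ A ∈ Q, A ∈ P) →
      5 * (Q.map fun A => ((C.uncovered F).filter (· ∈ C.verts A)).card).sum +
        15 * (Q.map fun A => (C.touched F A).card).sum ≤ 7 * (Q.map card).sum + 15 * Q.length := by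
    intro Q
    induction Q with
    | nil => simp
    | cons A Q ih =>
      intro hQ
      have h5 := ih fun B hB => hQ B (List.mem_cons_of_mem _ hB)
      obtain ⟨a1, a2, a3⟩ := h1 A (hQ A List.mem_cons_self)
      have h6 := hF.le_of_isConn a1 (a3.trans hTm) a2
      simp only [List.map_cons, List.sum_cons, List.length_cons]
      omega
  have := hsum P fun A hA => hA
  omega

/-! ### Completing a set of chords -/

/-- If no chord of a crossing-connected set separates two points of `V`, and each point of `V` is an
endpoint of such a chord, then `V` does not have three elements `x < y < z`: a chord at `y` would
end on one side of `y`, and connecting it to a chord at the point of `V` on the other side would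
require a crossing of `{x, y}` or `{y, z}`. -/
theorem not_three_common {V : Finset ℕ} {G : Finset ℕ} {r : ℕ}
    (hno : ∀ e, C.Conn G r e → ∀ x ∈ V, ∀ y ∈ V, ¬ Interleave (C.L e) (C.R e) x y)
    (hV : ∀ v ∈ V, ∃ e, C.Conn G r e ∧ (C.L e = v ∨ C.R e = v))
    {x y z : ℕ} (hx : x ∈ V) (hy : y ∈ V) (hz : z ∈ V) (hxy : x < y) (hyz : y < z) : False := by
  have key : ∀ p ∈ V, ∀ q ∈ V, ∀ i j, C.Conn G r i → C.Conn G i j →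
      ¬ Outside p q (C.L i) → ¬ Outside p q (C.R i) →
      ¬ Outside p q (C.L j) ∧ ¬ Outside p q (C.R j) := by
    intro p hp q hq i j hri hij h1 h2
    induction hij with
    | refl => exact ⟨h1, h2⟩
    | @tail l l' hl hll ih =>
      have h3 := hno l' ((hri.trans hl).tail hll) p hp q hq
      have h4 : Interleave _ _ _ _ := hll.2.2
      unfold Interleave Outside Btw at *
      omega
  obtain ⟨i, hi, hix⟩ := hV x hx
  obtain ⟨j, hj, hjy⟩ := hV y hy
  obtain ⟨k, hk, hkz⟩ := hV z hz
  have hout : ∀ p q v, p < q → (v < p ∨ q < v) → Outside p q v := by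
    unfold Outside Btw; omega
  have hin : ∀ p q v, p < q → p ≤ v → v ≤ q → ¬ Outside p q v := by
    unfold Outside Btw; omega
  -- the other end of the chord at `y` lies between `x` and `z`
  obtain ⟨w, hw, hwL⟩ : ∃ w, (x ≤ w ∧ w ≤ z) ∧
      (C.L j = y ∧ C.R j = w ∨ C.L j = w ∧ C.R j = y) := by
    have h1 := hno j hj x hx z hz
    unfold Interleave Outside Btw at h1
    rcases hjy with h | h
    · exact ⟨C.R j, by omega, Or.inl ⟨h, rfl⟩⟩
    · exact ⟨C.L j, by omega, Or.inr ⟨rfl, h⟩⟩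
  rcases Nat.le_total w y with hwy | hwy
  · have hL : ¬ Outside x y (C.L j) := hin _ _ _ hxy (by omega) (by omega)
    have hR : ¬ Outside x y (C.R j) := hin _ _ _ hxy (by omega) (by omega)
    have h2 := key x hx y hy j k hj (hj.symm.trans hk) hL hR
    have h3 := hout x y z hxy (Or.inr hyz)
    rcases hkz with h | h
    · exact h2.1 (h ▸ h3)
    · exact h2.2 (h ▸ h3)
  · have hL : ¬ Outside y z (C.L j) := hin _ _ _ hyz (by omega) (by omega)
    have hR : ¬ Outside y z (C.R j) := hin _ _ _ hyz (by omega) (by omega)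
    have h2 := key y hy z hz j i hj (hj.symm.trans hi) hL hR
    have h3 := hout y z x hyz (Or.inl hxy)
    rcases hix with h | h
    · exact h2.1 (h ▸ h3)
    · exact h2.2 (h ▸ h3)

/-- Two different components share at most two endpoints. -/
theorem card_verts_inter_le_two {F G : Finset ℕ} (hFG : F ⊆ G) {i r : ℕ} (hi : i ∈ F) (hr : r ∈ G)
    (h : ¬ C.comp F i ⊆ C.comp G r) :
    (C.verts (C.comp F i) ∩ C.verts (C.comp G r)).card ≤ 2 := by
  by_contra! hcard
  obtain ⟨x, hx, y, hy, z, hz, hxy, hxz, hyz⟩ := two_lt_card.1 hcard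
  have hnc : ¬ C.Conn G r i := by
    refine fun hri => h fun l hl => ?_
    rw [mem_comp] at hl ⊢
    exact ⟨hFG hl.1, hri.trans (hl.2.mono hFG)⟩
  have hno : ∀ e, C.Conn G r e → ∀ x ∈ C.verts (C.comp F i) ∩ C.verts (C.comp G r),
      ∀ y ∈ C.verts (C.comp F i) ∩ C.verts (C.comp G r), ¬ Interleave (C.L e) (C.R e) x y := by
    intro e he x hx y hy hI
    obtain ⟨k, hk, hkx⟩ := mem_verts.1 (mem_inter.1 hx).1
    obtain ⟨l, hl, hly⟩ := mem_verts.1 (mem_inter.1 hy).1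
    rw [mem_comp] at hk hl
    obtain ⟨f, hf, hfI⟩ := exists_cross_of_separates (hk.2.symm.trans hl.2) hkx hly hI
    have hfF := (hk.2.trans hf).mem hi
    exact hnc ((he.trans (Conn.of_cross (he.mem hr) (hFG hfF) hfI)).trans
      ((hk.2.trans hf).mono hFG).symm)
  have hV : ∀ v ∈ C.verts (C.comp F i) ∩ C.verts (C.comp G r),
      ∃ e, C.Conn G r e ∧ (C.L e = v ∨ C.R e = v) := by
    intro v hv
    obtain ⟨e, he, hev⟩ := mem_verts.1 (mem_inter.1 hv).2
    exact ⟨e, (mem_comp.1 he).2, hev⟩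
  have key := @not_three_common C _ G r hno hV
  rcases lt_or_gt_of_ne hxy with h1 | h1 <;> rcases lt_or_gt_of_ne hxz with h2 | h2 <;>
    rcases lt_or_gt_of_ne hyz with h3 | h3
  · exact key hx hy hz h1 h3
  · exact key hx hz hy h2 h3
  · omega
  · exact key hz hx hy h2 h1
  · exact key hy hx hz h1 h2
  · omega
  · exact key hy hz hx h3 h2
  · exact key hz hy hx h3 h1

/-- A bound for the number of chords which the component `M` still has to absorb until it reaches
all vertices: every vertex missed by both `F` and `M` counts once, and every component `K` of `F`
which is not part of `M` counts three minus the number of its endpoints that `M` has reached. -/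
noncomputable def defect (C : ChordSystem) (F M : Finset ℕ) : ℕ :=
  (C.uncovered F \ C.verts M).card +
    ∑ K ∈ F.image (C.comp F), if K ⊆ M then 0 else 3 - (C.verts K ∩ C.verts M).card

theorem defect_comp_add_three_le {F : Finset ℕ} {r : ℕ} (hr : r ∈ F) :
    C.defect F (C.comp F r) + 3 ≤ (C.uncovered F).card + 3 * C.numComp F := by
  have hmem : C.comp F r ∈ F.image (C.comp F) := mem_image_of_mem _ hr
  have h1 : (C.uncovered F \ C.verts (C.comp F r)).card ≤ (C.uncovered F).card :=
    card_le_card sdiff_subset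
  have h2 : ∑ K ∈ (F.image (C.comp F)).erase (C.comp F r),
      (if K ⊆ C.comp F r then 0 else 3 - (C.verts K ∩ C.verts (C.comp F r)).card) ≤
      ((F.image (C.comp F)).erase (C.comp F r)).card * 3 := by
    refine sum_le_card_nsmul _ _ _ fun K _ => ?_
    split_ifs <;> omega
  have h3 := card_pos.2 ⟨_, hmem⟩
  rw [card_erase_of_mem hmem] at h2
  unfold defect numComp
  rw [← add_sum_erase _ _ hmem, if_pos (Subset.refl _)]
  omega

theorem comp_mono {F G : Finset ℕ} (h : F ⊆ G) (r : ℕ) : C.comp F r ⊆ C.comp G r := by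
  intro i hi
  rw [mem_comp] at hi ⊢
  exact ⟨h hi.1, hi.2.mono h⟩

/-- Adding a chord `x` which crosses the component of `r` and reaches a new vertex `v` decreases
the defect. -/
theorem defect_insert_lt {F G : Finset ℕ} (hFG : F ⊆ G) {r x j v : ℕ} (hr : r ∈ G)
    (hj : j ∈ C.comp G r) (hxj : C.Cross x j) (hxv : C.L x = v ∨ C.R x = v) (hv : v < C.n)
    (hvM : v ∉ C.verts (C.comp G r)) :
    C.defect F (C.comp (insert x G) r) < C.defect F (C.comp G r) := by
  have hMM := comp_mono (C := C) (subset_insert x G) r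
  have hvv := verts_mono (C := C) hMM
  have hxM : x ∈ C.comp (insert x G) r := by
    have hj' := mem_comp.1 (hMM hj)
    exact mem_comp.2 ⟨mem_insert_self _ _,
      hj'.2.trans (Conn.of_cross hj'.1 (mem_insert_self _ _) hxj.symm)⟩
  have hvM' : v ∈ C.verts (C.comp (insert x G) r) := mem_verts.2 ⟨x, hxM, hxv⟩
  generalize C.comp (insert x G) r = M' at *
  have h1 : C.uncovered F \ C.verts M' ⊆ C.uncovered F \ C.verts (C.comp G r) :=
    sdiff_subset_sdiff (Subset.refl _) hvv
  have h2 : ∀ K ∈ F.image (C.comp F),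
      (if K ⊆ M' then 0 else 3 - (C.verts K ∩ C.verts M').card) ≤
      if K ⊆ C.comp G r then 0 else 3 - (C.verts K ∩ C.verts (C.comp G r)).card := by
    intro K _
    have := card_le_card (inter_subset_inter_left (s := C.verts K) hvv)
    by_cases hK : K ⊆ C.comp G r
    · rw [if_pos hK, if_pos (hK.trans hMM)]
    · rw [if_neg hK]
      split_ifs <;> omega
  unfold defect
  by_cases hvF : v ∈ C.verts F
  · obtain ⟨i, hi, hiv⟩ := mem_verts.1 hvF
    refine add_lt_add_of_le_of_lt (card_le_card h1)
      (sum_lt_sum h2 ⟨C.comp F i, mem_image_of_mem _ hi, ?_⟩)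
    have hvK : v ∈ C.verts (C.comp F i) := mem_verts.2 ⟨i, mem_comp.2 ⟨hi, Conn.refl i⟩, hiv⟩
    have hK : ¬ C.comp F i ⊆ C.comp G r := fun h => hvM (verts_mono h hvK)
    have hle := card_verts_inter_le_two hFG hi hr hK
    have hlt : (C.verts (C.comp F i) ∩ C.verts (C.comp G r)).card <
        (C.verts (C.comp F i) ∩ C.verts M').card := by
      refine card_lt_card ⟨inter_subset_inter_left hvv, fun h => hvM ?_⟩
      exact (mem_inter.1 (h (mem_inter.2 ⟨hvK, hvM'⟩))).2
    rw [if_neg hK]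
    split_ifs <;> omega
  · refine add_lt_add_of_lt_of_le (card_lt_card ⟨h1, fun h => ?_⟩) (sum_le_sum h2)
    have : v ∈ C.uncovered F \ C.verts M' :=
      h (mem_sdiff.2 ⟨mem_sdiff.2 ⟨mem_range.2 hv, hvF⟩, hvM⟩)
    exact (mem_sdiff.1 this).2 hvM'

/-- The chord `x` crosses the component of `r` in `G` and has an endpoint outside it. -/
def Extends (C : ChordSystem) (G : Finset ℕ) (r x : ℕ) : Prop :=
  (∃ j ∈ C.comp G r, C.Cross x j) ∧
    (C.L x ∉ C.verts (C.comp G r) ∨ C.R x ∉ C.verts (C.comp G r))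

theorem Extends.notMem {G : Finset ℕ} {r x : ℕ} (h : C.Extends G r x) : x ∉ G := by
  intro hx
  obtain ⟨⟨j, hj, hxj⟩, hv⟩ := h
  rw [mem_comp] at hj
  have : x ∈ C.comp G r := mem_comp.2 ⟨hx, hj.2.trans (Conn.of_cross hj.1 hx hxj.symm)⟩
  rcases hv with hv | hv
  · exact hv (mem_verts.2 ⟨x, this, Or.inl rfl⟩)
  · exact hv (mem_verts.2 ⟨x, this, Or.inr rfl⟩)

theorem Extends.defect_lt {F G : Finset ℕ} (hFG : F ⊆ G) {r x : ℕ} (hr : r ∈ G) (hx : x < C.m)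
    (h : C.Extends G r x) :
    C.defect F (C.comp (insert x G) r) < C.defect F (C.comp G r) := by
  obtain ⟨⟨j, hj, hxj⟩, hv⟩ := h
  have hlt : ∀ v, C.L x = v ∨ C.R x = v → v < C.n := fun v hv =>
    lt_of_mem_verts (F := {x}) (singleton_subset_iff.2 (mem_range.2 hx))
      (mem_verts.2 ⟨x, mem_singleton_self x, hv⟩)
  rcases hv with hv | hv
  · exact defect_insert_lt hFG hr hj hxj (Or.inl rfl) (hlt _ (Or.inl rfl)) hv
  · exact defect_insert_lt hFG hr hj hxj (Or.inr rfl) (hlt _ (Or.inr rfl)) hv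

/-- When no chord extends the component of `r` any more, it reaches all vertices. -/
theorem feasible_of_forall_not_extends {G : Finset ℕ} (hG : G ⊆ range C.m) {r : ℕ} (hr : r ∈ G)
    (h : ∀ x < C.m, ¬ C.Extends G r x) : C.Feasible G := by
  refine feasible_of_conn hr fun w hw => ?_
  by_contra! hw'
  have hMG : C.comp G r ⊆ range C.m := fun i hi => hG (mem_comp.1 hi).1
  have hrM : r ∈ C.comp G r := mem_comp.2 ⟨hr, Conn.refl r⟩
  have hwM : w ∉ C.verts (C.comp G r) := by
    intro h
    obtain ⟨i, hi, hiw⟩ := mem_verts.1 h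
    have := hw' i (mem_comp.1 hi).2
    tauto
  obtain ⟨u, hu, v, hv, hcut, hgap⟩ := exists_gap hMG ⟨r, hrM⟩ hw hwM
  obtain ⟨e, he, heI⟩ := C.complete u v hcut
  obtain ⟨i, hi, hiu⟩ := mem_verts.1 hu
  obtain ⟨j, hj, hjv⟩ := mem_verts.1 hv
  rw [mem_comp] at hi hj
  obtain ⟨l, hl, hlI⟩ := exists_cross_of_separates (hi.2.symm.trans hj.2) hiu hjv heI.symm
  have hrl := hi.2.trans hl
  exact h e he ⟨⟨l, mem_comp.2 ⟨hrl.mem hr, hrl⟩, hlI⟩, hgap _ _ heI⟩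

/-- The approximation guarantee: `F` is a local optimum whose potential is at most that of a single
chord, and `G` arises from `F` by a completion that pays for each chord with the defect.  With
`q = |T|` and `z = u + 3 * c - 3`, the bound for the potential and `n ≤ 2 * q` give
`7 * |F| + 5 * z ≤ 10 * q`, and local optimality gives `5 * z ≤ 7 * q + 22 * (q / 40)`, whence
`7 * |G| ≤ 7 * |F| + 7 * z ≤ 13.02 * q`. -/
theorem card_le_of_isLocalOpt {F G T : Finset ℕ} {r : ℕ} (hF : C.IsLocalOpt 80 F)
    (hFm : F ⊆ range C.m) (hr : r ∈ F) (hpot : C.potential F ≤ 5 * C.n + 12)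
    (hG : G.card ≤ F.card + C.defect F (C.comp F r)) (hT : C.Feasible T) (hTm : T ⊆ range C.m) :
    10000 * G.card ≤ 18704 * T.card := by
  obtain ⟨p, hp, h⟩ := IsLocalOpt.le_of_feasible (s := 40) (by norm_num) hF hFm hT hTm
  have h1 := hT.le_two_mul_card hTm
  have h2 := defect_comp_add_three_le (C := C) hr
  unfold potential at hpot
  omega

end ChordSystem

/-! ### Cuts and 3-connectivity -/

theorem cycleGraph_adj_iff {n : ℕ} (hn : 4 ≤ n) (c d : Fin n) :
    (SimpleGraph.cycleGraph n).Adj c d ↔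
      (c : ℕ) + 1 = d ∨ (d : ℕ) + 1 = c ∨ ((c : ℕ) = 0 ∧ (d : ℕ) + 1 = n) ∨
        ((d : ℕ) = 0 ∧ (c : ℕ) + 1 = n) := by
  rw [SimpleGraph.cycleGraph_adj']
  have hc := c.2
  have hd := d.2
  rw [Fin.val_sub, Fin.val_sub]
  have key : ∀ x y : ℕ, x < n → y < n →
      ((n - y + x) % n = 1 ↔ y + 1 = x ∨ (x = 0 ∧ y + 1 = n)) := by
    intro x y hx hy
    rcases Nat.lt_or_ge x y with h | h
    · rw [Nat.mod_eq_of_lt (by omega)]; omega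
    · rw [show n - y + x = (x - y) + n by omega, Nat.add_mod_right, Nat.mod_eq_of_lt (by omega)]
      omega
  rw [key c d hc hd, key d c hd hc]
  omega

theorem isChord_iff {n : ℕ} (hn : 4 ≤ n) (c d : Fin n) :
    IsChord n s(c, d) ↔ IsCut n c d ∨ IsCut n d c := by
  unfold IsChord IsCut
  rw [SimpleGraph.mem_edgeSet, SimpleGraph.compl_adj, cycleGraph_adj_iff hn, Ne, Fin.ext_iff]
  have hc := c.2
  have hd := d.2
  omega

/-- In a `3`-connected graph, deleting the two ends of a cut leaves a graph in which some link joins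
the two sides of the cut. -/
theorem ThreeConnects.exists_interleave {n : ℕ} {L : Finset (Sym2 (Fin n))} (hn : 4 ≤ n)
    (h : ThreeConnects n L) {u v : ℕ} (huv : IsCut n u v) :
    ∃ c d : Fin n, s(c, d) ∈ L ∧ Interleave u v c d := by
  have huv' := huv
  unfold IsCut at huv
  let u' : Fin n := ⟨u, by omega⟩
  let v' : Fin n := ⟨v, by omega⟩
  have hmem : ∀ w : Fin n, w ∉ ({u', v'} : Finset (Fin n)) ↔ (w : ℕ) ≠ u ∧ (w : ℕ) ≠ v := by
    intro w
    simp [u', v', Fin.ext_iff]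
  have hcon := (h.2 {u', v'} ((card_insert_le _ _).trans_lt (by simp))).preconnected
  obtain ⟨y, hyn, hy⟩ : ∃ y, y < n ∧ Outside u v y := by
    unfold Outside Btw
    rcases Nat.eq_zero_or_pos u with h0 | h0
    · exact ⟨v + 1, by omega, by omega⟩
    · exact ⟨0, by omega, by omega⟩
  by_contra! hno
  have hreach := hcon ⟨⟨u + 1, by omega⟩, (hmem _).2 ⟨by simp, by simp; omega⟩⟩
    ⟨⟨y, hyn⟩, (hmem _).2 ⟨hy.2.1, hy.2.2⟩⟩
  rw [SimpleGraph.reachable_iff_reflTransGen] at hreach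
  refine hy.1 ?_
  suffices key : ∀ x y : {w // w ∈ {w : Fin n | w ∉ ({u', v'} : Finset (Fin n))}},
      ReflTransGen (SimpleGraph.induce _ _).Adj x y → Btw u v (x.1 : ℕ) → Btw u v (y.1 : ℕ) from
    key _ _ hreach (by unfold Btw; simp only; omega)
  · intro x w hw hx
    induction hw with
    | refl => exact hx
    | @tail w w' _ hww ih =>
      have hw := (hmem _).1 w.2
      have hw' := (hmem _).1 w'.2
      rw [SimpleGraph.induce_adj, SimpleGraph.sup_adj, SimpleGraph.fromEdgeSet_adj,
        cycleGraph_adj_iff hn] at hww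
      rcases hww with hww | ⟨hww, -⟩
      · have := w.1.2
        have := w'.1.2
        unfold Btw at *
        omega
      · have := hno _ _ (Finset.mem_coe.1 hww)
        unfold Interleave Outside Btw at *
        omega

/-- If every cut is crossed, then the deletion of at most two vertices leaves one arc of the cycle,
or two arcs which are joined by a link. -/
theorem threeConnects_of_interleave {n : ℕ} {L : Finset (Sym2 (Fin n))} (hn : 4 ≤ n)
    (h : ∀ u v, IsCut n u v → ∃ c d : Fin n, s(c, d) ∈ L ∧ Interleave u v c d) :
    ThreeConnects n L := by
  refine ⟨by simp only [Fintype.card_fin]; omega, fun X hX => ?_⟩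
  set G := SimpleGraph.cycleGraph n ⊔ SimpleGraph.fromEdgeSet (L : Set (Sym2 (Fin n))) with hG
  let H := G.induce {w | w ∉ X}
  let J : ℕ → ℕ → Prop := fun i j =>
    ∀ (hi : i < n) (hj : j < n) (hi' : (⟨i, hi⟩ : Fin n) ∉ X) (hj' : (⟨j, hj⟩ : Fin n) ∉ X),
      H.Reachable ⟨⟨i, hi⟩, hi'⟩ ⟨⟨j, hj⟩, hj'⟩
  have hsymm : ∀ i j, J i j → J j i := fun i j h hj hi hj' hi' => (h hi hj hi' hj').symm
  have htrans : ∀ i j k (hj : j < n), (⟨j, hj⟩ : Fin n) ∉ X → J i j → J j k → J i k :=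
    fun i j k hj hj' h1 h2 hi hk hi' hk' => (h1 hi hj hi' hj').trans (h2 hj hk hj' hk')
  have hadj : ∀ c d : Fin n, (SimpleGraph.cycleGraph n).Adj c d → J c d :=
    fun c d hcd _ _ _ _ => SimpleGraph.Adj.reachable (Or.inl hcd)
  have hlink : ∀ c d : Fin n, s(c, d) ∈ L → c ≠ d → J c d := by
    intro c d hcd hne _ _ _ _
    refine SimpleGraph.Adj.reachable (Or.inr ?_)
    rw [SimpleGraph.fromEdgeSet_adj]
    exact ⟨hcd, hne⟩
  have hseg : ∀ i j, i ≤ j → j < n → (∀ k (hk : k < n), i ≤ k → k ≤ j → (⟨k, hk⟩ : Fin n) ∉ X) →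
      J i j := by
    intro i j hij
    induction j, hij using Nat.le_induction with
    | base => exact fun _ _ _ _ _ _ => SimpleGraph.Reachable.refl _
    | succ j hij ih =>
      intro hj hk
      refine htrans i j (j + 1) (by omega) (hk j _ hij (by omega))
        (ih (by omega) fun k hk' h1 h2 => hk k hk' h1 (by omega)) ?_
      exact hadj ⟨j, by omega⟩ ⟨j + 1, hj⟩ ((cycleGraph_adj_iff hn _ _).2 (Or.inl rfl))
  have hseg' : ∀ i j, i < n → j < n →
      (∀ k (hk : k < n), min i j ≤ k → k ≤ max i j → (⟨k, hk⟩ : Fin n) ∉ X) → J i j := by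
    intro i j hi hj hk
    rcases Nat.le_total i j with hij | hij
    · exact hseg i j hij hj fun k hk' h1 h2 => hk k hk' (by omega) (by omega)
    · exact hsymm _ _ (hseg j i hij hi fun k hk' h1 h2 => hk k hk' (by omega) (by omega))
  have hwrap : J 0 (n - 1) :=
    hadj ⟨0, by omega⟩ ⟨n - 1, by omega⟩ ((cycleGraph_adj_iff hn _ _).2
      (Or.inr (Or.inr (Or.inl ⟨rfl, by simp only; omega⟩))))
  have hall : ∀ i j (hi : i < n) (hj : j < n), (⟨i, hi⟩ : Fin n) ∉ X → (⟨j, hj⟩ : Fin n) ∉ X →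
      J i j := by
    rcases X.eq_empty_or_nonempty with rfl | hXne
    · exact fun i j hi hj _ _ => hseg' i j hi hj fun k hk _ _ => notMem_empty _
    · obtain ⟨u, v, huv, hvn, hmem⟩ : ∃ u v, u ≤ v ∧ v < n ∧
          ∀ k (hk : k < n), (⟨k, hk⟩ : Fin n) ∉ X ↔ k ≠ u ∧ k ≠ v := by
        have h1 : ∀ x ∈ X, X.min' hXne ≤ x := fun x hx => min'_le _ _ hx
        have h2 : ∀ x ∈ X, x ≤ X.max' hXne := fun x hx => le_max' _ _ hx
        have h3 := X.min'_mem hXne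
        have h4 := X.max'_mem hXne
        refine ⟨X.min' hXne, X.max' hXne, h2 _ h3, (X.max' hXne).2, fun k hk => ?_⟩
        generalize X.min' hXne = u at *
        generalize X.max' hXne = v at *
        constructor
        · intro hkX
          exact ⟨fun he => hkX (by convert h3), fun he => hkX (by convert h4)⟩
        · rintro ⟨hku, hkv⟩ hkX
          have : ({u, v, ⟨k, hk⟩} : Finset (Fin n)) ⊆ X := by
            intro x hx
            simp only [mem_insert, mem_singleton] at hx
            rcases hx with rfl | rfl | rfl <;> assumption
          have hle := card_le_card this
          have huv' : u ≠ v := by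
            rintro rfl
            have := le_antisymm (h2 _ hkX) (h1 _ hkX)
            exact hku (by rw [← this])
          rw [card_eq_three.2 ⟨u, v, ⟨k, hk⟩, huv', ?_, ?_, rfl⟩] at hle
          · omega
          · rintro rfl; exact hku rfl
          · rintro rfl; exact hkv rfl
      have hin : ∀ i j, u < i → i < v → u < j → j < v → J i j := fun i j h1 h2 h3 h4 =>
        hseg' i j (by omega) (by omega) fun k hk h5 h6 => (hmem k hk).2 (by omega)
      have hlo : ∀ i, i < u → J 0 i := fun i hi =>
        hseg' 0 i (by omega) (by omega) fun k hk h5 h6 => (hmem k hk).2 (by omega)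
      have hhi : ∀ i, v < i → i < n → J (n - 1) i := fun i hi hi' =>
        hseg' (n - 1) i (by omega) (by omega) fun k hk h5 h6 => (hmem k hk).2 (by omega)
      have hout : ∀ i j, Outside u v i → Outside u v j → i < n → j < n → J i j := by
        intro i j hi hj hin hjn
        have hi' : i < u ∨ v < i := by unfold Outside Btw at hi; omega
        have hj' : j < u ∨ v < j := by unfold Outside Btw at hj; omega
        rcases hi' with hi' | hi' <;> rcases hj' with hj' | hj'
        · exact htrans i 0 j (by omega) ((hmem _ _).2 (by omega)) (hsymm _ _ (hlo i hi'))
            (hlo j hj')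
        · refine htrans i 0 j (by omega) ((hmem _ _).2 (by omega)) (hsymm _ _ (hlo i hi')) ?_
          exact htrans _ _ _ (by omega) ((hmem _ _).2 (by omega)) hwrap (hhi j hj' hjn)
        · refine htrans i (n - 1) j (by omega) ((hmem _ _).2 (by omega))
            (hsymm _ _ (hhi i hi' hin)) ?_
          exact htrans _ 0 _ (by omega) ((hmem _ _).2 (by omega)) (hsymm _ _ hwrap) (hlo j hj')
        · exact htrans i (n - 1) j (by omega) ((hmem _ _).2 (by omega))
            (hsymm _ _ (hhi i hi' hin)) (hhi j hj' hjn)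
      have hmix : ∀ i j, u < i → i < v → Outside u v j → j < n → J i j := by
        intro i j h1 h2 h3 h4
        obtain ⟨c, d, hcd, hI⟩ := h u v (by unfold IsCut; unfold Outside Btw at h3; omega)
        have hne : c ≠ d := by
          rintro rfl
          unfold Interleave Outside Btw at hI; omega
        have hcn := c.2
        have hdn := d.2
        have hJ := hlink c d hcd hne
        rcases hI with ⟨hc, hd⟩ | ⟨hd, hc⟩
        · have hc' : u < (c : ℕ) ∧ (c : ℕ) < v := by unfold Btw at hc; omega
          refine htrans i c j hcn ((hmem _ _).2 (by omega)) (hin _ _ h1 h2 hc'.1 hc'.2) ?_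
          exact htrans c d j hdn ((hmem _ _).2 hd.2) hJ (hout _ _ hd h3 hdn h4)
        · have hd' : u < (d : ℕ) ∧ (d : ℕ) < v := by unfold Btw at hd; omega
          refine htrans i d j hdn ((hmem _ _).2 (by omega)) (hin _ _ h1 h2 hd'.1 hd'.2) ?_
          exact htrans d c j hcn ((hmem _ _).2 hc.2) (hsymm _ _ hJ) (hout _ _ hc h3 hcn h4)
      intro i j hi hj hiX hjX
      rw [hmem] at hiX hjX
      have hi' : (u < i ∧ i < v) ∨ Outside u v i := by unfold Outside Btw; omega
      have hj' : (u < j ∧ j < v) ∨ Outside u v j := by unfold Outside Btw; omega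
      rcases hi' with hi' | hi' <;> rcases hj' with hj' | hj'
      · exact hin _ _ hi'.1 hi'.2 hj'.1 hj'.2
      · exact hmix _ _ hi'.1 hi'.2 hj' hj
      · exact hsymm _ _ (hmix _ _ hj'.1 hj'.2 hi' hi)
      · exact hout _ _ hi' hj' hi hj
  have hne : ∃ w, w ∉ X := by
    by_contra! hw
    have : univ ⊆ X := fun w _ => hw w
    have := card_le_card this
    rw [card_univ, Fintype.card_fin] at this
    omega
  obtain ⟨w, hw⟩ := hne
  have : Nonempty ({w | w ∉ X} : Set (Fin n)) := ⟨⟨w, hw⟩⟩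
  exact SimpleGraph.Connected.mk fun x y =>
    hall x.1 y.1 x.1.2 y.1.2 x.2 y.2 x.1.2 y.1.2 x.2 y.2

/-! ### The chord system of an instance -/

/-- The chord system given by an enumeration `l` of the links of an instance. -/
def IsInstance.chordSystem {n : ℕ} {S : Finset (Sym2 (Fin n))} {l : List (Fin n × Fin n)}
    (hS : IsInstance n S) (hl : Enumerates l S) : ChordSystem where
  n := n
  m := l.length
  L i := if h : i < l.length then l[i].1 else 0
  R i := if h : i < l.length then l[i].2 else 0
  four_le := hS.four_le
  chord i hi := by
    rw [dif_pos hi, dif_pos hi, ← isChord_iff hS.four_le]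
    refine hS.isChord _ ?_
    rw [← hl.2, List.mem_toFinset]
    exact List.mem_map_of_mem (List.getElem_mem hi)
  complete u v huv := by
    obtain ⟨c, d, hcd, hI⟩ := hS.threeConnects.exists_interleave hS.four_le huv
    rw [← hl.2, List.mem_toFinset, List.mem_map] at hcd
    obtain ⟨e, he, hecd⟩ := hcd
    obtain ⟨i, hi, rfl⟩ := List.mem_iff_getElem.1 he
    refine ⟨i, hi, ?_⟩
    rw [dif_pos hi, dif_pos hi]
    rcases Sym2.eq_iff.1 hecd with ⟨h1, h2⟩ | ⟨h1, h2⟩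
    · rw [h1, h2]; exact hI
    · rw [h1, h2]; exact hI.swap_right

/-- A feasible solution corresponds to a feasible set of indices of the same size. -/
theorem IsInstance.exists_feasible {n : ℕ} {S : Finset (Sym2 (Fin n))} {l : List (Fin n × Fin n)}
    (hS : IsInstance n S) (hl : Enumerates l S) {T : Finset (Sym2 (Fin n))}
    (hT : IsFeasible n S T) :
    ∃ I ⊆ range (hS.chordSystem hl).m, (hS.chordSystem hl).Feasible I ∧ I.card ≤ T.card := by
  classical
  let f : Sym2 (Fin n) → ℕ := fun e => (l.map fun c => s(c.1, c.2)).idxOf e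
  have hlen : (l.map fun c => s(c.1, c.2)).length = l.length := List.length_map _
  have hf : ∀ e ∈ T, ∃ h : f e < l.length, s(l[f e].1, l[f e].2) = e := by
    intro e he
    have hmem : e ∈ l.map fun c => s(c.1, c.2) := by
      rw [← List.mem_toFinset, hl.2]
      exact hT.1 he
    have h1 : f e < (l.map fun c => s(c.1, c.2)).length := List.idxOf_lt_length_of_mem hmem
    refine ⟨hlen ▸ h1, ?_⟩
    have := List.getElem_idxOf h1
    rwa [List.getElem_map] at this
  refine ⟨T.image f, ?_, ?_, card_image_le⟩
  · intro i hi
    obtain ⟨e, he, rfl⟩ := mem_image.1 hi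
    exact mem_range.2 (hf e he).1
  · intro u v huv
    obtain ⟨c, d, hcd, hI⟩ := hT.2.exists_interleave hS.four_le huv
    obtain ⟨h1, h2⟩ := hf _ hcd
    refine ⟨f s(c, d), mem_image_of_mem _ hcd, ?_⟩
    change Interleave u v (if h : f s(c, d) < l.length then (l[f s(c, d)].1 : ℕ) else 0)
      (if h : f s(c, d) < l.length then (l[f s(c, d)].2 : ℕ) else 0)
    rw [dif_pos h1, dif_pos h1]
    rcases Sym2.eq_iff.1 h2 with ⟨h3, h4⟩ | ⟨h3, h4⟩
    · rw [h3, h4]; exact hI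
    · rw [h3, h4]; exact hI.swap_right

/-- A memory in which array `2` marks exactly the indices in `I` describes at most `|I|` links,
and a feasible solution if `I` is feasible. -/
theorem IsInstance.isFeasible_output {n : ℕ} {S : Finset (Sym2 (Fin n))}
    {l : List (Fin n × Fin n)} (hS : IsInstance n S) (hl : Enumerates l S) {M : RAM.Memory}
    {I : Finset ℕ} (hI : ∀ i < l.length, M.arr 2 i ≠ 0 ↔ i ∈ I) (hIm : I ⊆ range l.length)
    (hfeas : (hS.chordSystem hl).Feasible I) :
    IsFeasible n S (output l M) ∧ (output l M).card ≤ I.card := by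
  classical
  refine ⟨⟨?_, threeConnects_of_interleave hS.four_le fun u v huv => ?_⟩, ?_⟩
  · intro e he
    obtain ⟨i, -, rfl⟩ := mem_image.1 he
    rw [← hl.2, List.mem_toFinset]
    exact List.mem_map_of_mem (List.getElem_mem i.2)
  · obtain ⟨i, hi, hint⟩ := hfeas u v huv
    have him := mem_range.1 (hIm hi)
    refine ⟨l[i].1, l[i].2, mem_image.2 ⟨⟨i, him⟩, ?_, rfl⟩, ?_⟩
    · rw [mem_filter]
      exact ⟨mem_univ _, (hI i him).2 hi⟩
    · change Interleave u v (if h : i < l.length then (l[i].1 : ℕ) else 0)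
        (if h : i < l.length then (l[i].2 : ℕ) else 0) at hint
      rwa [dif_pos him, dif_pos him] at hint
  · refine card_image_le.trans ?_
    refine card_le_card_of_injOn (fun i => (i : ℕ)) ?_ (fun i _ j _ h => Fin.ext h)
    intro i hi
    exact (hI i i.2).1 (mem_filter.1 hi).2

end CycleVCA

namespace RAM

/-! ### Running times of programs -/

/-- Started with memory `M`, the program `p` halts within `T` steps with a memory satisfying `Q`. -/
def Runs (p : Program) (M : Memory) (T : ℕ) (Q : Memory → Prop) : Prop :=
  ∃ M' t, Run p M M' t ∧ t ≤ T ∧ Q M'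

theorem Runs.mono {p : Program} {M : Memory} {T T' : ℕ} {Q Q' : Memory → Prop}
    (h : Runs p M T Q) (hT : T ≤ T') (hQ : ∀ M', Q M' → Q' M') : Runs p M T' Q' := by
  obtain ⟨M', t, h1, h2, h3⟩ := h
  exact ⟨M', t, h1, h2.trans hT, hQ _ h3⟩

theorem Runs.seq {p q : Program} {M : Memory} {T₁ T₂ : ℕ} {Q R : Memory → Prop}
    (hp : Runs p M T₁ Q) (hq : ∀ M', Q M' → Runs q M' T₂ R) :
    Runs (.seq p q) M (T₁ + T₂) R := by
  obtain ⟨M₁, t₁, h1, h2, h3⟩ := hp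
  obtain ⟨M₂, t₂, h4, h5, h6⟩ := hq _ h3
  exact ⟨M₂, t₁ + t₂, .seq h1 h4, by omega, h6⟩

theorem Runs.ite {p q : Program} {x y : ℕ} {M : Memory} {T : ℕ} {Q : Memory → Prop}
    (hp : M.reg x < M.reg y → Runs p M T Q) (hq : ¬ M.reg x < M.reg y → Runs q M T Q) :
    Runs (.ite x y p q) M (T + 1) Q := by
  by_cases h : M.reg x < M.reg y
  · obtain ⟨M₁, t₁, h1, h2, h3⟩ := hp h
    exact ⟨M₁, t₁ + 1, .ite_true h h1, by omega, h3⟩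
  · obtain ⟨M₁, t₁, h1, h2, h3⟩ := hq h
    exact ⟨M₁, t₁ + 1, .ite_false h h1, by omega, h3⟩

theorem Runs.const_seq {x c : ℕ} {q : Program} {M : Memory} {T : ℕ} {Q : Memory → Prop}
    (h : Runs q (M.setReg x c) T Q) : Runs (.seq (.const x c) q) M (T + 1) Q := by
  obtain ⟨M₁, t₁, h1, h2, h3⟩ := h
  exact ⟨M₁, 1 + t₁, .seq (.const x c M) h1, by omega, h3⟩

theorem Runs.add_seq {x y z : ℕ} {q : Program} {M : Memory} {T : ℕ} {Q : Memory → Prop}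
    (h : Runs q (M.setReg x (M.reg y + M.reg z)) T Q) :
    Runs (.seq (.add x y z) q) M (T + 1) Q := by
  obtain ⟨M₁, t₁, h1, h2, h3⟩ := h
  exact ⟨M₁, 1 + t₁, .seq (.add x y z M) h1, by omega, h3⟩

theorem Runs.const {x c : ℕ} {M : Memory} {Q : Memory → Prop} (h : Q (M.setReg x c)) :
    Runs (.const x c) M 1 Q := ⟨_, _, .const x c M, le_rfl, h⟩

theorem Runs.add {x y z : ℕ} {M : Memory} {Q : Memory → Prop}
    (h : Q (M.setReg x (M.reg y + M.reg z))) : Runs (.add x y z) M 1 Q :=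
  ⟨_, _, .add x y z M, le_rfl, h⟩

theorem Runs.sub {x y z : ℕ} {M : Memory} {Q : Memory → Prop}
    (h : Q (M.setReg x (M.reg y - M.reg z))) : Runs (.sub x y z) M 1 Q :=
  ⟨_, _, .sub x y z M, le_rfl, h⟩

theorem Runs.load {x a y : ℕ} {M : Memory} {Q : Memory → Prop}
    (h : Q (M.setReg x (M.arr a (M.reg y)))) : Runs (.load x a y) M 1 Q :=
  ⟨_, _, .load x a y M, le_rfl, h⟩

theorem Runs.store {a x y : ℕ} {M : Memory} {Q : Memory → Prop}
    (h : Q (M.setArr a (M.reg x) (M.reg y))) : Runs (.store a x y) M 1 Q :=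
  ⟨_, _, .store a x y M, le_rfl, h⟩

theorem Memory.setReg_self (M : Memory) {x v : ℕ} : (M.setReg x v).reg x = v :=
  Function.update_self _ _ _

theorem Memory.setArr_self (M : Memory) {a i v : ℕ} :
    (M.setArr a i v).arr a = Function.update (M.arr a) i v := Function.update_self _ _ _

theorem Memory.setReg_of_ne (M : Memory) {x y v : ℕ} (h : y ≠ x) :
    (M.setReg x v).reg y = M.reg y := Function.update_of_ne h _ _

theorem Memory.setReg_setReg (M : Memory) (x v w : ℕ) :
    (M.setReg x v).setReg x w = M.setReg x w := by
  simp [Memory.setReg]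

/-- A loop whose counter `c` is incremented by the body runs `n - i` times. -/
theorem Runs.loop {c b : ℕ} {p : Program} {n T : ℕ} {I : ℕ → Memory → Prop}
    (hI : ∀ i M, I i M → M.reg c = i ∧ M.reg b = n)
    (hp : ∀ i < n, ∀ M, I i M → Runs p M T (I (i + 1))) :
    ∀ k i M, i + k = n → I i M → Runs (.loop c b p) M (k * (T + 1) + 1) (I n) := by
  intro k
  induction k with
  | zero =>
    intro i M hi hM
    obtain ⟨h1, h2⟩ := hI i M hM
    exact ⟨M, 1, .loop_false (by omega), by omega, by rwa [← hi]⟩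
  | succ k ih =>
    intro i M hi hM
    obtain ⟨h1, h2⟩ := hI i M hM
    obtain ⟨M₁, t₁, h3, h4, h5⟩ := hp i (by omega) M hM
    obtain ⟨M₂, t₂, h6, h7, h8⟩ := ih (i + 1) M₁ (by omega) h5
    refine ⟨M₂, t₁ + t₂ + 1, .loop_true (by omega) h3 h6, ?_, h8⟩
    rw [Nat.succ_mul]
    omega

/-! ### Arithmetic expressions with bounded sums -/

/-- Arithmetic expressions over the registers and the arrays.  `cond c t f` is `t` if `c` is
positive and `f` otherwise; `sum x b e` is the sum of the values of `e` as register `x` runs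
through the numbers below the value of register `b`. -/
inductive Exp where
  | const (c : ℕ) : Exp
  | var (x : ℕ) : Exp
  | add (e f : Exp) : Exp
  | sub (e f : Exp) : Exp
  | load (a : ℕ) (e : Exp) : Exp
  | cond (c t f : Exp) : Exp
  | sum (x b : ℕ) (e : Exp) : Exp

namespace Exp

/-- The value of an expression when the arrays are `A` and the registers are `r`. -/
def eval (A : ℕ → ℕ → ℕ) : Exp → (ℕ → ℕ) → ℕ
  | const c, _ => c
  | var x, r => r x
  | add e f, r => e.eval A r + f.eval A r
  | sub e f, r => e.eval A r - f.eval A r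
  | load a e, r => A a (e.eval A r)
  | cond c t f, r => if 0 < c.eval A r then t.eval A r else f.eval A r
  | sum x b e, r => ∑ i ∈ Finset.range (r b), e.eval A (Function.update r x i)

/-- All registers are below `D`, and the bounds of the sums are the registers `0` and `1`, which
are not used as summation variables. -/
def Ok (D : ℕ) : Exp → Prop
  | const _ => True
  | var x => x < D
  | add e f => e.Ok D ∧ f.Ok D
  | sub e f => e.Ok D ∧ f.Ok D
  | load _ e => e.Ok D
  | cond c t f => c.Ok D ∧ t.Ok D ∧ f.Ok D
  | sum x b e => 2 ≤ x ∧ x < D ∧ b < 2 ∧ e.Ok D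

/-- A program which computes the value of the expression in register `d`, and otherwise changes only
registers above `d`. -/
def compile : Exp → ℕ → Program
  | const c, d => .const d c
  | var x, d => .seq (.const d 0) (.add d d x)
  | add e f, d => .seq (e.compile d) (.seq (f.compile (d + 1)) (.add d d (d + 1)))
  | sub e f, d => .seq (e.compile d) (.seq (f.compile (d + 1)) (.sub d d (d + 1)))
  | load a e, d => .seq (e.compile d) (.load d a d)
  | cond c t f, d => .seq (c.compile d) (.seq (.const (d + 1) 0)
      (.ite (d + 1) d (t.compile d) (f.compile d)))
  | sum x b e, d => .seq (.const d 0) (.seq (.add (d + 2) d x) (.seq (.add (d + 3) d b)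
      (.seq (.const (d + 1) 0) (.seq (.loop (d + 1) (d + 3)
        (.seq (.const x 0) (.seq (.add x x (d + 1)) (.seq (e.compile (d + 4))
          (.seq (.add d d (d + 4)) (.seq (.const (d + 4) 1) (.add (d + 1) (d + 1) (d + 4))))))))
        (.seq (.const x 0) (.add x x (d + 2)))))))

/-- The running time of the compiled expression, as a polynomial in a bound for the registers `0`
and `1`. -/
noncomputable def cost : Exp → Polynomial ℕ
  | const _ => 1
  | var _ => 2
  | add e f => e.cost + f.cost + 1
  | sub e f => e.cost + f.cost + 1
  | load _ e => e.cost + 1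
  | cond c t f => c.cost + t.cost + f.cost + 2
  | sum _ _ e => Polynomial.X * (e.cost + 6) + 7

theorem eval_congr {D : ℕ} (A : ℕ → ℕ → ℕ) {e : Exp} (he : e.Ok D) :
    ∀ {r r' : ℕ → ℕ}, (∀ x < D, r x = r' x) → e.eval A r = e.eval A r' := by
  induction e with
  | const c => intro r r' _; rfl
  | var x => intro r r' h; exact h x he
  | add e f ihe ihf => intro r r' h; simp only [eval]; rw [ihe he.1 h, ihf he.2 h]
  | sub e f ihe ihf => intro r r' h; simp only [eval]; rw [ihe he.1 h, ihf he.2 h]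
  | load a e ih => intro r r' h; simp only [eval]; rw [ih he h]
  | cond c t f ihc iht ihf =>
    intro r r' h; simp only [eval]; rw [ihc he.1 h, iht he.2.1 h, ihf he.2.2 h]
  | sum x b e ih =>
    intro r r' h
    obtain ⟨h1, h2, h3, h4⟩ := he
    simp only [eval]
    rw [h b (by omega)]
    refine Finset.sum_congr rfl fun i _ => ih h4 fun y hy => ?_
    by_cases hyx : y = x
    · subst hyx; simp
    · rw [Function.update_of_ne hyx, Function.update_of_ne hyx, h y hy]

/-- The compiled expression computes its value within the cost.  Registers from `D` on are free for
intermediate results. -/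
theorem compile_runs {D : ℕ} (hD : 2 ≤ D) {e : Exp} (he : e.Ok D) :
    ∀ {d : ℕ} (_ : D ≤ d) {N : ℕ} {M : Memory} (_ : M.reg 0 ≤ N) (_ : M.reg 1 ≤ N),
    Runs (e.compile d) M (e.cost.eval N) fun M' =>
      M'.reg d = e.eval M.arr M.reg ∧ (∀ x < d, M'.reg x = M.reg x) ∧ M'.arr = M.arr := by
  induction e with
  | const c =>
    intro d hd N M _ _
    refine (Runs.const ⟨by simp [eval, Memory.setReg_self], fun x hx => ?_, rfl⟩).mono
      (by simp [cost]) fun _ h => h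
    exact Memory.setReg_of_ne _ (by omega)
  | var x =>
    intro d hd N M _ _
    have hx : x < d := lt_of_lt_of_le he hd
    refine (Runs.const_seq (Runs.add ⟨?_, fun y hy => ?_, rfl⟩)).mono (by simp [cost])
      fun _ h => h
    · rw [Memory.setReg_self, Memory.setReg_self, Memory.setReg_of_ne _ (by omega), Nat.zero_add]
      rfl
    · rw [Memory.setReg_of_ne _ (by omega), Memory.setReg_of_ne _ (by omega)]
  | add e f ihe ihf =>
    intro d hd N M h0 h1
    refine ((ihe he.1 hd h0 h1).seq (T₂ := f.cost.eval N + 1) (R := _) ?_).mono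
      (by simp [cost, add_assoc]) fun _ h => h
    rintro M₁ ⟨e1, e2, e3⟩
    refine (ihf he.2 (d := d + 1) (by omega) (by rwa [e2 0 (by omega)])
      (by rwa [e2 1 (by omega)])).seq ?_
    rintro M₂ ⟨f1, f2, f3⟩
    refine Runs.add ⟨?_, fun x hx => ?_, f3.trans e3⟩
    · rw [Memory.setReg_self, f1, f2 d (by omega), e1, e3,
        eval_congr _ he.2 (r' := M.reg) fun x hx => e2 x (by omega)]
      rfl
    · rw [Memory.setReg_of_ne _ (by omega), f2 x (by omega), e2 x hx]
  | sub e f ihe ihf =>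
    intro d hd N M h0 h1
    refine ((ihe he.1 hd h0 h1).seq (T₂ := f.cost.eval N + 1) (R := _) ?_).mono
      (by simp [cost, add_assoc]) fun _ h => h
    rintro M₁ ⟨e1, e2, e3⟩
    refine (ihf he.2 (d := d + 1) (by omega) (by rwa [e2 0 (by omega)])
      (by rwa [e2 1 (by omega)])).seq ?_
    rintro M₂ ⟨f1, f2, f3⟩
    refine Runs.sub ⟨?_, fun x hx => ?_, f3.trans e3⟩
    · rw [Memory.setReg_self, f1, f2 d (by omega), e1, e3,
        eval_congr _ he.2 (r' := M.reg) fun x hx => e2 x (by omega)]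
      rfl
    · rw [Memory.setReg_of_ne _ (by omega), f2 x (by omega), e2 x hx]
  | load a e ih =>
    intro d hd N M h0 h1
    refine ((ih he hd h0 h1).seq (T₂ := 1) (R := _) ?_).mono (by simp [cost]) fun _ h => h
    rintro M₁ ⟨e1, e2, e3⟩
    refine Runs.load ⟨?_, fun x hx => ?_, e3⟩
    · rw [Memory.setReg_self, e1, e3]
      rfl
    · rw [Memory.setReg_of_ne _ (by omega), e2 x hx]
  | cond c t f ihc iht ihf =>
    intro d hd N M h0 h1
    refine ((ihc he.1 hd h0 h1).seq (T₂ := t.cost.eval N + f.cost.eval N + 1 + 1) (R := _)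
      ?_).mono (by simp [cost]; omega) fun _ h => h
    rintro M₁ ⟨c1, c2, c3⟩
    refine Runs.const_seq ?_
    have h0' : (M₁.setReg (d + 1) 0).reg 0 ≤ N := by
      rwa [Memory.setReg_of_ne _ (by omega), c2 0 (by omega)]
    have h1' : (M₁.setReg (d + 1) 0).reg 1 ≤ N := by
      rwa [Memory.setReg_of_ne _ (by omega), c2 1 (by omega)]
    have heq : ∀ x < d, (M₁.setReg (d + 1) 0).reg x = M.reg x := fun x hx => by
      rw [Memory.setReg_of_ne _ (by omega), c2 x hx]
    have hcd : (M₁.setReg (d + 1) 0).reg (d + 1) < (M₁.setReg (d + 1) 0).reg d ↔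
        0 < c.eval M.arr M.reg := by
      rw [Memory.setReg_self, Memory.setReg_of_ne _ (by omega), c1]
    refine Runs.ite ?_ ?_
    · rw [hcd]
      intro hpos
      refine (iht he.2.1 hd h0' h1').mono (by omega) fun M₂ ⟨t1, t2, t3⟩ => ?_
      refine ⟨?_, fun x hx => by rw [t2 x hx, heq x hx], t3.trans c3⟩
      rw [t1, eval_congr _ he.2.1 (r' := M.reg) fun x hx => heq x (by omega)]
      change eval M₁.arr t M.reg = _
      simp only [eval]
      rw [if_pos hpos, c3]
    · rw [hcd]
      intro hpos
      refine (ihf he.2.2 hd h0' h1').mono (by omega) fun M₂ ⟨t1, t2, t3⟩ => ?_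
      refine ⟨?_, fun x hx => by rw [t2 x hx, heq x hx], t3.trans c3⟩
      rw [t1, eval_congr _ he.2.2 (r' := M.reg) fun x hx => heq x (by omega)]
      change eval M₁.arr f M.reg = _
      simp only [eval]
      rw [if_neg hpos, c3]
  | sum x b e ih =>
    intro d hd N M h0 h1
    obtain ⟨hx2, hxD, hb, he⟩ := he
    have hbN : M.reg b ≤ N := by
      have : b = 0 ∨ b = 1 := by omega
      rcases this with rfl | rfl <;> assumption
    -- register `d` accumulates the sum, `d + 1` counts, `d + 2` saves the old value of `x`, and
    -- `d + 3` keeps the bound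
    let I : ℕ → Memory → Prop := fun i M' =>
      M'.reg d = ∑ j ∈ Finset.range i, e.eval M.arr (Function.update M.reg x j) ∧
      M'.reg (d + 1) = i ∧ M'.reg (d + 2) = M.reg x ∧ M'.reg (d + 3) = M.reg b ∧
      (∀ y < d, y ≠ x → M'.reg y = M.reg y) ∧ M'.arr = M.arr
    have hbody : ∀ i < M.reg b, ∀ M', I i M' → Runs
        (.seq (.const x 0) (.seq (.add x x (d + 1)) (.seq (e.compile (d + 4))
          (.seq (.add d d (d + 4)) (.seq (.const (d + 4) 1) (.add (d + 1) (d + 1) (d + 4)))))))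
        M' (e.cost.eval N + (1 + 1 + 1) + 1 + 1) (I (i + 1)) := by
      rintro i hi M' ⟨i1, i2, i3, i4, i5, i6⟩
      refine Runs.const_seq (Runs.add_seq ?_)
      rw [Memory.setReg_setReg, Memory.setReg_self, Memory.setReg_of_ne _ (by omega), i2,
        Nat.zero_add]
      have hupd : ∀ y < d, (M'.setReg x i).reg y = Function.update M.reg x i y := by
        intro y hy
        by_cases hyx : y = x
        · subst hyx
          rw [Memory.setReg_self, Function.update_self]
        · rw [Memory.setReg_of_ne _ hyx, Function.update_of_ne hyx, i5 y hy hyx]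
      refine (ih he (d := d + 4) (by omega)
        (by rwa [hupd 0 (by omega), Function.update_of_ne (by omega)])
        (by rwa [hupd 1 (by omega), Function.update_of_ne (by omega)])).seq ?_
      rintro M₂ ⟨e1, e2, e3⟩
      refine Runs.add_seq (Runs.const_seq (Runs.add ⟨?_, ?_, ?_, ?_, ?_, ?_⟩))
      · rw [Memory.setReg_of_ne _ (by omega), Memory.setReg_of_ne _ (by omega),
          Memory.setReg_self, e1, e2 d (by omega), Memory.setReg_of_ne _ (by omega), i1,
          Finset.sum_range_succ,
          eval_congr _ he (r' := Function.update M.reg x i) fun y hy => hupd y (by omega)]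
        change _ + eval M'.arr e _ = _
        rw [i6]
      · rw [Memory.setReg_self, Memory.setReg_self, Memory.setReg_of_ne _ (by omega),
          Memory.setReg_of_ne _ (by omega), e2 _ (by omega), Memory.setReg_of_ne _ (by omega), i2]
      · rw [Memory.setReg_of_ne _ (by omega), Memory.setReg_of_ne _ (by omega),
          Memory.setReg_of_ne _ (by omega), e2 _ (by omega), Memory.setReg_of_ne _ (by omega), i3]
      · rw [Memory.setReg_of_ne _ (by omega), Memory.setReg_of_ne _ (by omega),
          Memory.setReg_of_ne _ (by omega), e2 _ (by omega), Memory.setReg_of_ne _ (by omega), i4]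
      · intro y hy hyx
        rw [Memory.setReg_of_ne _ (by omega), Memory.setReg_of_ne _ (by omega),
          Memory.setReg_of_ne _ (by omega), e2 _ (by omega), Memory.setReg_of_ne _ hyx, i5 y hy hyx]
      · exact e3.trans i6
    refine (Runs.const_seq (Runs.add_seq (Runs.add_seq (Runs.const_seq
      ((Runs.loop (n := M.reg b) (I := I) (fun i M' h => ⟨h.2.1, h.2.2.2.1⟩) hbody (M.reg b) 0 _
        (Nat.zero_add _) ⟨?_, ?_, ?_, ?_, ?_, ?_⟩).seq (T₂ := 1 + 1) ?_))))).mono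
      (Q := fun M' => M'.reg d = (sum x b e).eval M.arr M.reg ∧ (∀ x < d, M'.reg x = M.reg x) ∧
        M'.arr = M.arr) ?_ fun _ h => h
    · rw [Memory.setReg_of_ne _ (by omega), Memory.setReg_of_ne _ (by omega),
        Memory.setReg_of_ne _ (by omega), Memory.setReg_self, Finset.range_zero, Finset.sum_empty]
    · rw [Memory.setReg_self]
    · rw [Memory.setReg_of_ne _ (by omega), Memory.setReg_of_ne _ (by omega), Memory.setReg_self,
        Memory.setReg_self, Memory.setReg_of_ne _ (by omega), Nat.zero_add]
    · rw [Memory.setReg_of_ne _ (by omega), Memory.setReg_self, Memory.setReg_of_ne _ (by omega),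
        Memory.setReg_self, Memory.setReg_of_ne _ (by omega), Memory.setReg_of_ne _ (by omega),
        Nat.zero_add]
    · intro y hy _
      rw [Memory.setReg_of_ne _ (by omega), Memory.setReg_of_ne _ (by omega),
        Memory.setReg_of_ne _ (by omega), Memory.setReg_of_ne _ (by omega)]
    · rfl
    · rintro M' ⟨i1, i2, i3, i4, i5, i6⟩
      refine Runs.const_seq (Runs.add ⟨?_, ?_, i6⟩)
      · rw [Memory.setReg_of_ne _ (by omega), Memory.setReg_of_ne _ (by omega), i1]
        rfl
      · intro y hy
        by_cases hyx : y = x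
        · subst hyx
          rw [Memory.setReg_self, Memory.setReg_self, Memory.setReg_of_ne _ (by omega), i3,
            Nat.zero_add]
        · rw [Memory.setReg_of_ne _ hyx, Memory.setReg_of_ne _ hyx, i5 y hy hyx]
    · have : M.reg b * (e.cost.eval N + (1 + 1 + 1) + 1 + 1 + 1) ≤ N * (e.cost.eval N + 6) :=
        Nat.mul_le_mul_right _ hbN
      simp only [cost, Polynomial.eval_add, Polynomial.eval_mul, Polynomial.eval_X,
        Polynomial.eval_ofNat]
      omega

/-! Truth values: a condition holds if the value of its expression is positive. -/

/-- Conjunction. -/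
def and (e f : Exp) : Exp := cond e f (const 0)

/-- Disjunction. -/
def or (e f : Exp) : Exp := add e f

/-- Negation. -/
def not (e : Exp) : Exp := sub (const 1) e

/-- The comparison `e < f`. -/
def lt (e f : Exp) : Exp := sub f e

/-- The comparison `e = f`. -/
def eq (e f : Exp) : Exp := not (or (lt e f) (lt f e))

section
variable {A : ℕ → ℕ → ℕ} {r : ℕ → ℕ} {e f : Exp}

theorem eval_and : 0 < (e.and f).eval A r ↔ 0 < e.eval A r ∧ 0 < f.eval A r := by
  simp only [and, eval]; split_ifs with h <;> simp [h]

theorem eval_or : 0 < (e.or f).eval A r ↔ 0 < e.eval A r ∨ 0 < f.eval A r := by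
  simp only [or, eval]; omega

theorem eval_not : 0 < (Exp.not e).eval A r ↔ ¬ 0 < e.eval A r := by
  simp only [not, eval]; omega

theorem eval_lt : 0 < (e.lt f).eval A r ↔ e.eval A r < f.eval A r := by
  simp only [lt, eval]; omega

theorem eval_eq : 0 < (e.eq f).eval A r ↔ e.eval A r = f.eval A r := by
  rw [eq, eval_not, eval_or, eval_lt, eval_lt]; omega

theorem eval_sum {x b : ℕ} :
    0 < (sum x b e).eval A r ↔ ∃ i < r b, 0 < e.eval A (Function.update r x i) := by
  simp only [eval, Finset.sum_pos_iff, Finset.mem_range]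

end

end Exp

/-! ### Statements with bounded loops -/

/-- Apply `f 0, …, f (n - 1)` in this order. -/
def iter {α : Type*} (f : ℕ → α → α) : ℕ → α → α
  | 0, a => a
  | n + 1, a => f n (iter f n a)

/-- Statements: assignments to registers and array cells, sequences, conditionals (the first branch
is taken if the value of the condition is positive), and loops in which a register runs through the
numbers below the value of another register. -/
inductive Stmt where
  | assign (x : ℕ) (e : Exp) : Stmt
  | store (a : ℕ) (e f : Exp) : Stmt
  | seq (s t : Stmt) : Stmt
  | cond (e : Exp) (s : Stmt) : Stmt
  | forBelow (x b : ℕ) (s : Stmt) : Stmt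

namespace Stmt

/-- The effect of a statement on the memory. -/
def run : Stmt → Memory → Memory
  | assign x e, M => M.setReg x (e.eval M.arr M.reg)
  | store a e f, M => M.setArr a (e.eval M.arr M.reg) (f.eval M.arr M.reg)
  | seq s t, M => t.run (s.run M)
  | cond e s, M => if 0 < e.eval M.arr M.reg then s.run M else M
  | .forBelow x b s, M => iter (fun i M => s.run (M.setReg x i)) (M.reg b) M

/-- All registers are below `D`, and the registers `0` and `1`, which are the only ones used as
bounds of loops, are not modified. -/
def Ok (D : ℕ) : Stmt → Prop
  | assign x e => 2 ≤ x ∧ x < D ∧ e.Ok D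
  | store _ e f => e.Ok D ∧ f.Ok D
  | seq s t => s.Ok D ∧ t.Ok D
  | cond e s => e.Ok D ∧ s.Ok D
  | .forBelow x b s => 2 ≤ x ∧ x < D ∧ b < 2 ∧ s.Ok D

/-- A program with the same effect on the arrays and on the registers used by the statement; the
registers from `d` on hold intermediate results. -/
def compile : Stmt → ℕ → Program
  | assign x e, d => .seq (e.compile d) (.seq (.const (d + 1) 0) (.add x d (d + 1)))
  | store a e f, d => .seq (e.compile d) (.seq (f.compile (d + 1)) (.store a d (d + 1)))
  | seq s t, d => .seq (s.compile d) (t.compile d)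
  | cond e s, d => .seq (e.compile d) (.seq (.const (d + 1) 0) (.ite (d + 1) d (s.compile d) .skip))
  | .forBelow x b s, d => .seq (.const d 0) (.seq (.add (d + 1) d b) (.loop d (d + 1)
      (.seq (.const x 0) (.seq (.add x x d) (.seq (s.compile (d + 2))
        (.seq (.const (d + 2) 1) (.add d d (d + 2))))))))

/-- The running time of the compiled statement, as a polynomial in a bound for the registers `0`
and `1`. -/
noncomputable def cost : Stmt → Polynomial ℕ
  | assign _ e => e.cost + 2
  | store _ e f => e.cost + f.cost + 1
  | seq s t => s.cost + t.cost
  | cond e s => e.cost + s.cost + 3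
  | .forBelow _ _ s => Polynomial.X * (s.cost + 5) + 3

/-- The register `x` is not modified by the statement. -/
def KeepsReg (x : ℕ) : Stmt → Prop
  | assign y _ => x ≠ y
  | store _ _ _ => True
  | seq s t => s.KeepsReg x ∧ t.KeepsReg x
  | cond _ s => s.KeepsReg x
  | .forBelow y _ s => x ≠ y ∧ s.KeepsReg x

/-- The array `a` is not modified by the statement. -/
def KeepsArr (a : ℕ) : Stmt → Prop
  | assign _ _ => True
  | store b _ _ => a ≠ b
  | seq s t => s.KeepsArr a ∧ t.KeepsArr a
  | cond _ s => s.KeepsArr a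
  | .forBelow _ _ s => s.KeepsArr a

/-- Invariants of loops. -/
theorem run_for_induct {x b : ℕ} {s : Stmt} {M : Memory} (P : ℕ → Memory → Prop) (h0 : P 0 M)
    (hs : ∀ i < M.reg b, ∀ M', P i M' → P (i + 1) (s.run (M'.setReg x i))) :
    P (M.reg b) ((Stmt.forBelow x b s).run M) := by
  simp only [run]
  have : ∀ k ≤ M.reg b, P k (iter (fun i M => s.run (M.setReg x i)) k M) := by
    intro k
    induction k with
    | zero => exact fun _ => h0
    | succ k ih => exact fun hk => hs k hk _ (ih (by omega))
  exact this _ le_rfl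

theorem KeepsReg.run_reg {x : ℕ} {s : Stmt} (hs : s.KeepsReg x) :
    ∀ M : Memory, (s.run M).reg x = M.reg x := by
  induction s with
  | assign y e => exact fun M => Memory.setReg_of_ne _ hs
  | store a e f => exact fun M => rfl
  | seq s t ihs iht => exact fun M => (iht hs.2 _).trans (ihs hs.1 M)
  | cond e s ih =>
    intro M
    simp only [run]
    split_ifs
    · exact ih hs M
    · rfl
  | forBelow y b s ih =>
    intro M
    refine run_for_induct (fun _ M' => M'.reg x = M.reg x) rfl fun i _ M' h => ?_
    rw [ih hs.2, Memory.setReg_of_ne _ hs.1, h]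

theorem KeepsArr.run_arr {a : ℕ} {s : Stmt} (hs : s.KeepsArr a) :
    ∀ M : Memory, (s.run M).arr a = M.arr a := by
  induction s with
  | assign y e => exact fun M => rfl
  | store b e f => exact fun M => Function.update_of_ne hs _ _
  | seq s t ihs iht => exact fun M => (iht hs.2 _).trans (ihs hs.1 M)
  | cond e s ih =>
    intro M
    simp only [run]
    split_ifs
    · exact ih hs M
    · rfl
  | forBelow y b s ih =>
    intro M
    exact run_for_induct (fun _ M' => M'.arr a = M.arr a) rfl fun i _ M' h => (ih hs _).trans h

theorem Ok.keepsReg {D x : ℕ} (hx : x < 2) {s : Stmt} (hs : s.Ok D) : s.KeepsReg x := by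
  induction s with
  | assign y e => exact (lt_of_lt_of_le hx hs.1).ne
  | store a e f => trivial
  | seq s t ihs iht => exact ⟨ihs hs.1, iht hs.2⟩
  | cond e s ih => exact ih hs.2
  | forBelow y b s ih => exact ⟨(lt_of_lt_of_le hx hs.1).ne, ih hs.2.2.2⟩

theorem run_reg_lt_two {D : ℕ} {s : Stmt} (hs : s.Ok D) (M : Memory) (x : ℕ) (hx : x < 2) :
    (s.run M).reg x = M.reg x := (hs.keepsReg hx).run_reg M

/-- The compiled statement has the effect of the statement on the arrays and on the registers below
`D`, within the cost.  The memories `M₀` and `M` may differ in the registers for intermediate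
results. -/
theorem compile_runs {D : ℕ} (hD : 2 ≤ D) {s : Stmt} (hs : s.Ok D) :
    ∀ {d : ℕ} (_ : D ≤ d) {N : ℕ} {M₀ M : Memory} (_ : M₀.reg 0 ≤ N) (_ : M₀.reg 1 ≤ N)
      (_ : ∀ x < D, M.reg x = M₀.reg x) (_ : M.arr = M₀.arr),
    Runs (s.compile d) M (s.cost.eval N) fun M' => (∀ x < D, M'.reg x = (s.run M₀).reg x) ∧
      M'.arr = (s.run M₀).arr ∧ ∀ x < d, D ≤ x → M'.reg x = M.reg x := by
  induction s with
  | assign x e =>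
    intro d hd N M₀ M h0 h1 hreg harr
    obtain ⟨hx2, hxD, he⟩ := hs
    refine ((Exp.compile_runs hD he hd (M := M) (N := N) (by rwa [hreg 0 (by omega)])
      (by rwa [hreg 1 (by omega)])).seq (T₂ := 1 + 1) (R := _) ?_).mono (by simp [cost])
      fun _ h => h
    rintro M₁ ⟨e1, e2, e3⟩
    refine Runs.const_seq (Runs.add ⟨fun y hy => ?_, e3.trans harr, fun y hy hy' => ?_⟩)
    · by_cases hyx : y = x
      · subst hyx
        simp only [run]
        rw [Memory.setReg_self, Memory.setReg_self, Memory.setReg_self,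
          Memory.setReg_of_ne _ (by omega), e1, harr, Exp.eval_congr _ he hreg, Nat.add_zero]
      · simp only [run]
        rw [Memory.setReg_of_ne _ hyx, Memory.setReg_of_ne _ hyx,
          Memory.setReg_of_ne _ (by omega), e2 y (by omega), hreg y hy]
    · rw [Memory.setReg_of_ne _ (by omega), Memory.setReg_of_ne _ (by omega), e2 y hy]
  | store a e f =>
    intro d hd N M₀ M h0 h1 hreg harr
    have h0' : M.reg 0 ≤ N := by rwa [hreg 0 (by omega)]
    have h1' : M.reg 1 ≤ N := by rwa [hreg 1 (by omega)]
    refine ((Exp.compile_runs hD hs.1 hd h0' h1').seq (T₂ := f.cost.eval N + 1) (R := _) ?_).mono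
      (by simp [cost, add_assoc]) fun _ h => h
    rintro M₁ ⟨e1, e2, e3⟩
    refine (Exp.compile_runs hD hs.2 (d := d + 1) (by omega) (by rwa [e2 0 (by omega)])
      (by rwa [e2 1 (by omega)])).seq ?_
    rintro M₂ ⟨f1, f2, f3⟩
    refine Runs.store ⟨fun y hy => ?_, ?_, fun y hy hy' => ?_⟩
    · exact (f2 y (by omega)).trans ((e2 y (by omega)).trans (hreg y hy))
    · rw [f1, f2 d (by omega), e1, e3, Exp.eval_congr _ hs.2 (r' := M₀.reg) fun y hy =>
        (e2 y (by omega)).trans (hreg y hy), Exp.eval_congr _ hs.1 hreg, harr]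
      simp only [run, Memory.setArr]
      rw [f3, e3, harr]
    · exact (f2 y (by omega)).trans (e2 y (by omega))
  | seq s t ihs iht =>
    intro d hd N M₀ M h0 h1 hreg harr
    refine ((ihs hs.1 hd h0 h1 hreg harr).seq (T₂ := t.cost.eval N) (R := _) ?_).mono
      (by simp [cost]) fun _ h => h
    rintro M₁ ⟨s1, s2, s3⟩
    refine (iht hs.2 hd (by rwa [run_reg_lt_two hs.1 M₀ 0 (by omega)])
      (by rwa [run_reg_lt_two hs.1 M₀ 1 (by omega)]) s1 s2).mono le_rfl fun M₂ h => ?_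
    exact ⟨h.1, h.2.1, fun x hx hx' => (h.2.2 x hx hx').trans (s3 x hx hx')⟩
  | cond e s ih =>
    intro d hd N M₀ M h0 h1 hreg harr
    refine ((Exp.compile_runs hD hs.1 hd (M := M) (N := N) (by rwa [hreg 0 (by omega)])
      (by rwa [hreg 1 (by omega)])).seq (T₂ := s.cost.eval N + 1 + 1 + 1) (R := _) ?_).mono
      (by simp [cost]; omega) fun _ h => h
    rintro M₁ ⟨e1, e2, e3⟩
    refine Runs.const_seq (Runs.ite ?_ ?_)
    · rw [Memory.setReg_self, Memory.setReg_of_ne _ (by omega), e1, harr,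
        Exp.eval_congr _ hs.1 hreg]
      intro hpos
      refine (ih hs.2 hd (M := M₁.setReg (d + 1) 0) h0 h1 (fun x hx => ?_) (e3.trans harr)).mono
        (by omega) fun M₂ h => ?_
      · rw [Memory.setReg_of_ne _ (by omega), e2 x (by omega), hreg x hx]
      · simp only [run]
        rw [if_pos hpos]
        refine ⟨h.1, h.2.1, fun x hx hx' => ?_⟩
        rw [h.2.2 x hx hx', Memory.setReg_of_ne _ (by omega), e2 x (by omega)]
    · rw [Memory.setReg_self, Memory.setReg_of_ne _ (by omega), e1, harr,
        Exp.eval_congr _ hs.1 hreg]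
      intro hpos
      refine ⟨_, 1, .skip _, by omega, ?_⟩
      simp only [run]
      rw [if_neg hpos]
      refine ⟨fun x hx => ?_, e3.trans harr, fun x hx _ => ?_⟩
      · rw [Memory.setReg_of_ne _ (by omega), e2 x (by omega), hreg x hx]
      · rw [Memory.setReg_of_ne _ (by omega), e2 x (by omega)]
  | forBelow x b s ih =>
    intro d hd N M₀ M h0 h1 hreg harr
    obtain ⟨hx2, hxD, hb, hs⟩ := hs
    have hbN : M₀.reg b ≤ N := by
      have : b = 0 ∨ b = 1 := by omega
      rcases this with rfl | rfl <;> assumption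
    let S : ℕ → Memory := fun i => iter (fun i M => s.run (M.setReg x i)) i M₀
    have hS : ∀ i, ∀ y < 2, (S i).reg y = M₀.reg y := by
      intro i y hy
      induction i with
      | zero => rfl
      | succ i ihi =>
        refine (run_reg_lt_two hs _ y hy).trans ?_
        rw [Memory.setReg_of_ne _ (by omega)]
        exact ihi
    -- register `d` counts and `d + 1` keeps the bound, so that the body may use both `x` and `b`
    let I : ℕ → Memory → Prop := fun i M' =>
      M'.reg d = i ∧ M'.reg (d + 1) = M₀.reg b ∧ (∀ y < D, M'.reg y = (S i).reg y) ∧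
        M'.arr = (S i).arr ∧ ∀ y < d, D ≤ y → M'.reg y = M.reg y
    have hbody : ∀ i < M₀.reg b, ∀ M', I i M' → Runs
        (.seq (.const x 0) (.seq (.add x x d) (.seq (s.compile (d + 2))
          (.seq (.const (d + 2) 1) (.add d d (d + 2))))))
        M' (s.cost.eval N + (1 + 1) + 1 + 1) (I (i + 1)) := by
      rintro i hi M' ⟨i1, i2, i3, i4, i5⟩
      refine Runs.const_seq (Runs.add_seq ?_)
      rw [Memory.setReg_setReg, Memory.setReg_self, Memory.setReg_of_ne _ (by omega), i1,
        Nat.zero_add]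
      refine (ih hs (d := d + 2) (N := N) (M₀ := (S i).setReg x i) (M := M'.setReg x i)
        (by omega) ?_ ?_ ?_ i4).seq ?_
      · rwa [Memory.setReg_of_ne _ (by omega), hS i 0 (by omega)]
      · rwa [Memory.setReg_of_ne _ (by omega), hS i 1 (by omega)]
      · intro y hy
        by_cases hyx : y = x
        · subst hyx
          rw [Memory.setReg_self, Memory.setReg_self]
        · rw [Memory.setReg_of_ne _ hyx, Memory.setReg_of_ne _ hyx, i3 y hy]
      · rintro M₂ ⟨s1, s2, s3⟩
        refine Runs.const_seq (Runs.add ⟨?_, ?_, ?_, s2, ?_⟩)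
        · rw [Memory.setReg_self, Memory.setReg_self, Memory.setReg_of_ne _ (by omega),
            s3 d (by omega) (by omega), Memory.setReg_of_ne _ (by omega), i1]
        · rw [Memory.setReg_of_ne _ (by omega), Memory.setReg_of_ne _ (by omega),
            s3 (d + 1) (by omega) (by omega), Memory.setReg_of_ne _ (by omega), i2]
        · intro y hy
          rw [Memory.setReg_of_ne _ (by omega), Memory.setReg_of_ne _ (by omega)]
          exact s1 y hy
        · intro y hy hy'
          rw [Memory.setReg_of_ne _ (by omega), Memory.setReg_of_ne _ (by omega),
            s3 y (by omega) hy', Memory.setReg_of_ne _ (by omega), i5 y hy hy']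
    refine (Runs.const_seq (Runs.add_seq (Runs.loop (n := M₀.reg b) (I := I)
      (fun i M' h => ⟨h.1, h.2.1⟩) hbody (M₀.reg b) 0 _
        (Nat.zero_add _) ⟨?_, ?_, ?_, ?_, ?_⟩))).mono ?_ fun M' h => ⟨h.2.2.1, h.2.2.2⟩
    · rw [Memory.setReg_of_ne _ (by omega), Memory.setReg_self]
    · rw [Memory.setReg_self, Memory.setReg_self, Memory.setReg_of_ne _ (by omega),
        hreg b (by omega), Nat.zero_add]
    · intro y hy
      rw [Memory.setReg_of_ne _ (by omega), Memory.setReg_of_ne _ (by omega)]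
      exact hreg y hy
    · exact harr
    · intro y hy _
      rw [Memory.setReg_of_ne _ (by omega), Memory.setReg_of_ne _ (by omega)]
    · have : M₀.reg b * (s.cost.eval N + (1 + 1) + 1 + 1 + 1) ≤ N * (s.cost.eval N + 5) :=
        Nat.mul_le_mul_right _ hbN
      simp only [cost, Polynomial.eval_add, Polynomial.eval_mul, Polynomial.eval_X,
        Polynomial.eval_ofNat]
      omega

end Stmt

/-! ### Progress of iterations -/

/-- Each step of an iteration either finds its test satisfied and leaves the key unchanged, or finds
it violated and decreases the measure.  Then the whole iteration either finds all tests satisfied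
by the initial key and leaves it unchanged, or decreases the measure. -/
theorem iter_progress {α β : Type*} {f : ℕ → α → α} {N : ℕ} {Inv : α → Prop} (key : α → β)
    (μ : β → ℕ) (T : ℕ → β → Prop)
    (hf : ∀ i < N, ∀ a, Inv a → Inv (f i a) ∧
      ((T i (key a) ∧ key (f i a) = key a) ∨ (¬ T i (key a) ∧ μ (key (f i a)) < μ (key a))))
    {a : α} (ha : Inv a) :
    Inv (iter f N a) ∧ (((∀ i < N, T i (key a)) ∧ key (iter f N a) = key a) ∨
      (¬ (∀ i < N, T i (key a)) ∧ μ (key (iter f N a)) < μ (key a))) := by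
  induction N with
  | zero => exact ⟨ha, Or.inl ⟨fun i hi => absurd hi (Nat.not_lt_zero i), rfl⟩⟩
  | succ N ih =>
    obtain ⟨h1, h2⟩ := ih fun i hi => hf i (by omega)
    obtain ⟨h3, h4⟩ := hf N (by omega) _ h1
    refine ⟨h3, ?_⟩
    rcases h2 with ⟨h2, h2'⟩ | ⟨h2, h2'⟩
    · rw [h2'] at h4
      rcases h4 with ⟨h4, h4'⟩ | ⟨h4, h4'⟩
      · refine Or.inl ⟨fun i hi => ?_, h4'⟩
        rcases Nat.lt_succ_iff_lt_or_eq.1 hi with h | rfl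
        · exact h2 i h
        · exact h4
      · exact Or.inr ⟨fun h => h4 (h N (by omega)), h4'⟩
    · refine Or.inr ⟨fun h => h2 fun i hi => h i (by omega), lt_of_le_of_lt ?_ h2'⟩
      rcases h4 with ⟨-, h4⟩ | ⟨-, h4⟩
      · exact (congrArg μ h4).le
      · exact h4.le

/-- If each step preserves `T`, and establishes `T` or decreases the measure by at least `c`, then
`N` steps establish `T` or decrease the measure by at least `N * c`. -/
theorem iter_fixpoint {α : Type*} {f : ℕ → α → α} {N c : ℕ} {Inv T : α → Prop} (μ : α → ℕ)
    (hf : ∀ i < N, ∀ a, Inv a → Inv (f i a) ∧ (T a → T (f i a)) ∧ (T (f i a) ∨ μ (f i a) + c ≤ μ a))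
    {a : α} (ha : Inv a) :
    Inv (iter f N a) ∧ (T a → T (iter f N a)) ∧
      (T (iter f N a) ∨ μ (iter f N a) + N * c ≤ μ a) := by
  induction N with
  | zero => exact ⟨ha, id, Or.inr (by simp [iter])⟩
  | succ N ih =>
    obtain ⟨h1, h2, h3⟩ := ih fun i hi => hf i (by omega)
    obtain ⟨h4, h5, h6⟩ := hf N (by omega) _ h1
    refine ⟨h4, fun h => h5 (h2 h), ?_⟩
    rcases h3 with h3 | h3
    · exact Or.inl (h5 h3)
    · rcases h6 with h6 | h6
      · exact Or.inl h6
      · right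
        rw [Nat.succ_mul]
        change μ (f N (iter f N a)) + _ ≤ _
        omega

end RAM

namespace CycleVCA
open Finset Relation RAM

/-! ### The program

Register `0` holds the number of vertices and register `1` the number of links.  Arrays `0` and `1`
hold the endpoints of the links, array `2` marks the selected links, array `3` counts how often a
link occurs in the tuple under trial, array `5` marks the set of links whose crossing components
are computed, and array `4` labels these components. -/

namespace Prog

/-- Register `x` lies strictly between `a` and `b`. -/
def btw (a b x : Exp) : Exp := ((a.lt x).and (x.lt b)).or ((b.lt x).and (x.lt a))

/-- `x` lies strictly outside the interval spanned by `a` and `b`. -/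
def outside (a b x : Exp) : Exp :=
  (Exp.not (btw a b x)).and ((Exp.not (x.eq a)).and (Exp.not (x.eq b)))

/-- The links whose indices are in the registers `x` and `y` cross. -/
def cross (x y : ℕ) : Exp :=
  ((btw (.load 0 (.var x)) (.load 1 (.var x)) (.load 0 (.var y))).and
      (outside (.load 0 (.var x)) (.load 1 (.var x)) (.load 1 (.var y)))).or
    ((btw (.load 0 (.var x)) (.load 1 (.var x)) (.load 1 (.var y))).and
      (outside (.load 0 (.var x)) (.load 1 (.var x)) (.load 0 (.var y))))

/-- The link whose index is in register `x` has the endpoint `v`. -/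
def hasEnd (x : ℕ) (v : Exp) : Exp :=
  ((Exp.load 0 (.var x)).eq v).or ((Exp.load 1 (.var x)).eq v)

/-- Fill array `a` with the values of `e` for the values of register `2` below the number of
links. -/
def fill (a : ℕ) (e : Exp) : Stmt := .forBelow 2 1 (.store a (.var 2) e)

/-- If the links in registers `2` and `3` are marked and cross, and the label of the second is
smaller, then pass it on to the first. -/
def relax : Stmt :=
  .cond ((Exp.load 5 (.var 2)).and ((Exp.load 5 (.var 3)).and ((cross 2 3).and
      ((Exp.load 4 (.var 3)).lt (.load 4 (.var 2))))))
    (.store 4 (.var 2) (.load 4 (.var 3)))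

/-- Label the crossing components of the set marked in array `5`: starting from the indices of the
links, smaller labels are passed on.  As the sum of the labels is less than the square of the number
of links and decreases in each pass that is not idle, that many passes suffice. -/
def label : Stmt :=
  .seq (fill 4 (.var 2)) (.forBelow 8 1 (.forBelow 9 1 (.forBelow 2 1 (.forBelow 3 1 relax))))

/-- The potential of the set marked in array `5`, once its components are labelled. -/
def potentialExp : Exp :=
  ((Exp.sum 2 1 (.cond (.load 5 (.var 2)) (.const 7) (.const 0))).add
    (.sum 4 0 (.cond (.sum 2 1 ((Exp.load 5 (.var 2)).and (hasEnd 2 (.var 4))))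
      (.const 0) (.const 5)))).add
    (.sum 2 1 (.cond ((Exp.load 5 (.var 2)).and ((Exp.load 4 (.var 2)).eq (.var 2)))
      (.const 15) (.const 0)))

/-- Put the potential of the set marked in array `5` into register `6`. -/
def potential : Stmt := .seq label (.assign 6 potentialExp)

/-- Add the links of the tuple under trial to the selected ones if this decreases the potential. -/
def check : Stmt :=
  .seq (fill 5 (.load 2 (.var 2))) (.seq potential (.seq (.assign 7 (.var 6))
    (.seq (fill 5 ((Exp.load 2 (.var 2)).add (.load 3 (.var 2)))) (.seq potential
      (.cond ((Exp.var 6).lt (.var 7)) (fill 2 (.load 5 (.var 2))))))))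

/-- Run through all extensions of the tuple under trial by `j` links.  The registers from `11` on
hold the tuple, one link each. -/
def search : ℕ → Stmt
  | 0 => check
  | j + 1 => .forBelow (11 + j) 1
      (.seq (.store 3 (.var (11 + j)) ((Exp.load 3 (.var (11 + j))).add (.const 1)))
        (.seq (search j)
          (.store 3 (.var (11 + j)) ((Exp.load 3 (.var (11 + j))).sub (.const 1)))))

/-- The link in register `x` is marked in array `5` and belongs to the component of link `0`. -/
def inMain (x : ℕ) : Exp :=
  (Exp.load 5 (.var x)).and ((Exp.load 4 (.var x)).eq (.load 4 (.const 0)))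

/-- The link in register `5` crosses the component of link `0` and has an endpoint outside it. -/
def extendsExp : Exp :=
  (Exp.sum 3 1 ((inMain 3).and (cross 5 3))).and
    ((Exp.not (.sum 3 1 ((inMain 3).and (hasEnd 3 (.load 0 (.var 5)))))).or
      (Exp.not (.sum 3 1 ((inMain 3).and (hasEnd 3 (.load 1 (.var 5)))))))

/-- Select the link in register `5` if it extends the component of link `0`. -/
def extend : Stmt :=
  .seq (fill 5 (.load 2 (.var 2))) (.seq label (.cond extendsExp (.store 2 (.var 5) (.const 1))))

/-- Select link `0`, add tuples of `k` links as long as the potential decreases, and then extend the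
component of link `0` as long as possible.  Every pass of either phase which is not idle selects a
new link, so that as many passes as there are links suffice. -/
def main (k : ℕ) : Stmt :=
  .seq (.store 2 (.const 0) (.const 1))
    (.seq (.forBelow 10 1 (search k)) (.forBelow 10 1 (.forBelow 5 1 extend)))

theorem search_ok (D : ℕ) : ∀ j, 11 + j ≤ D → (search j).Ok D := by
  intro j
  induction j with
  | zero =>
    intro h
    simp only [search, check, fill, potential, label, relax, potentialExp, cross, hasEnd, btw,
      outside, Stmt.Ok, Exp.Ok, Exp.and, Exp.or, Exp.not, Exp.lt, Exp.eq, and_true, true_and]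
    omega
  | succ j ih =>
    intro h
    simp only [search, Stmt.Ok, Exp.Ok]
    have := ih (by omega)
    refine ⟨by omega, by omega, by omega, ⟨by omega, by omega, trivial⟩, this, by omega, by omega,
      trivial⟩

theorem main_ok (k : ℕ) : (main k).Ok (11 + k) := by
  refine ⟨⟨trivial, trivial⟩, ⟨by omega, by omega, by omega, search_ok _ k le_rfl⟩, ?_⟩
  simp only [extend, fill, label, relax, extendsExp, inMain, cross, hasEnd, btw,
      outside, Stmt.Ok, Exp.Ok, Exp.and, Exp.or, Exp.not, Exp.lt, Exp.eq,
    and_true, true_and]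
  omega

theorem search_keepsReg (j x : ℕ) (hx : 11 + j ≤ x ∨ x < 2) : (search j).KeepsReg x := by
  induction j with
  | zero =>
    simp only [search, check, fill, potential, label, relax, Stmt.KeepsReg, and_true]
    omega
  | succ j ih => exact ⟨by omega, trivial, ih (by omega), trivial⟩

theorem eval_cross {A : ℕ → ℕ → ℕ} {r : ℕ → ℕ} {x y : ℕ} : 0 < (cross x y).eval A r ↔
    Interleave (A 0 (r x)) (A 1 (r x)) (A 0 (r y)) (A 1 (r y)) := by
  simp only [cross, btw, outside, Exp.eval_and, Exp.eval_or, Exp.eval_not, Exp.eval_lt,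
    Exp.eval_eq, Interleave, Btw, Outside]
  simp only [Exp.eval]

theorem eval_hasEnd {A : ℕ → ℕ → ℕ} {r : ℕ → ℕ} {x : ℕ} {v : Exp} :
    0 < (hasEnd x v).eval A r ↔ A 0 (r x) = v.eval A r ∨ A 1 (r x) = v.eval A r := by
  simp only [hasEnd, Exp.eval_or, Exp.eval_eq]
  simp only [Exp.eval]

/-- The value written at `i` may depend on `i` and on the arrays other than the one that is
filled. -/
theorem fill_run {a : ℕ} {e : Exp} {M : Memory} (v : ℕ → ℕ)
    (hv : ∀ i < M.reg 1, ∀ M' : Memory, (∀ b ≠ a, M'.arr b = M.arr b) → M'.reg 2 = i →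
      e.eval M'.arr M'.reg = v i) :
    ∀ i < M.reg 1, ((fill a e).run M).arr a i = v i := by
  refine (Stmt.run_for_induct (x := 2) (b := 1) (s := .store a (.var 2) e) (M := M)
    (fun k M' => (∀ b ≠ a, M'.arr b = M.arr b) ∧ ∀ i < k, M'.arr a i = v i)
    ⟨fun _ _ => rfl, fun i hi => absurd hi (Nat.not_lt_zero i)⟩ ?_).2
  rintro k hk M' ⟨h1, h2⟩
  have hval := hv k hk (M'.setReg 2 k) h1 (Memory.setReg_self _)
  simp only [Stmt.run, Exp.eval, Memory.setReg_self, hval]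
  refine ⟨fun b hb => (Function.update_of_ne hb _ _).trans (h1 b hb), fun i hi => ?_⟩
  simp only [Memory.setArr, Function.update_self]
  rcases Nat.lt_succ_iff_lt_or_eq.1 hi with h | rfl
  · rw [Function.update_of_ne h.ne]
    exact h2 i h
  · rw [Function.update_self]

end Prog

/-! ### The effect of the program -/

namespace ChordSystem

variable {C : ChordSystem}

/-- The memory `M` holds the data of `C`. -/
structure Holds (C : ChordSystem) (M : Memory) : Prop where
  reg_zero : M.reg 0 = C.n
  reg_one : M.reg 1 = C.m
  arr_zero : M.arr 0 = C.L
  arr_one : M.arr 1 = C.R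

/-- The indices of chords which are marked by the array `A`. -/
def marked (C : ChordSystem) (A : ℕ → ℕ) : Finset ℕ := (range C.m).filter fun i => 0 < A i

theorem mem_marked {A : ℕ → ℕ} {i : ℕ} : i ∈ C.marked A ↔ i < C.m ∧ 0 < A i := by
  simp [marked]

theorem marked_congr {A B : ℕ → ℕ} (h : ∀ i < C.m, A i = B i) : C.marked A = C.marked B :=
  filter_congr fun i hi => by rw [h i (mem_range.1 hi)]

theorem marked_subset (A : ℕ → ℕ) : C.marked A ⊆ range C.m := filter_subset _ _

theorem m_pos (C : ChordSystem) : 0 < C.m := by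
  have := C.four_le
  obtain ⟨i, hi, -⟩ := C.complete 0 2 (by unfold IsCut; omega)
  omega

theorem Holds.of_keeps {M M' : Memory} (hM : C.Holds M) (h0 : M'.reg 0 = M.reg 0)
    (h1 : M'.reg 1 = M.reg 1) (h2 : M'.arr 0 = M.arr 0) (h3 : M'.arr 1 = M.arr 1) : C.Holds M' :=
  ⟨h0.trans hM.1, h1.trans hM.2, h2.trans hM.3, h3.trans hM.4⟩

theorem Holds.run {M : Memory} (hM : C.Holds M) {s : Stmt}
    (h : (s.KeepsReg 0 ∧ s.KeepsReg 1) ∧ s.KeepsArr 0 ∧ s.KeepsArr 1) : C.Holds (s.run M) :=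
  hM.of_keeps (h.1.1.run_reg M) (h.1.2.run_reg M) (h.2.1.run_arr M) (h.2.2.run_arr M)

theorem Holds.setReg {M : Memory} (hM : C.Holds M) {x v : ℕ} (hx : 2 ≤ x) :
    C.Holds (M.setReg x v) :=
  hM.of_keeps (Memory.setReg_of_ne _ (by omega)) (Memory.setReg_of_ne _ (by omega)) rfl rfl

theorem Holds.eval_cross {M : Memory} (hM : C.Holds M) {r : ℕ → ℕ} {x y : ℕ} :
    0 < (Prog.cross x y).eval M.arr r ↔ C.Cross (r x) (r y) := by
  rw [Prog.eval_cross, hM.3, hM.4]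
  rfl

/-! #### Labelling the components -/

/-- While the components of `C.marked B` are computed, labels are passed on within components. -/
structure LabelInv (C : ChordSystem) (B : ℕ → ℕ) (M : Memory) : Prop where
  holds : C.Holds M
  arr_five : M.arr 5 = B
  conn : ∀ i ∈ C.marked B, C.Conn (C.marked B) i (M.arr 4 i)

theorem LabelInv.setReg {B : ℕ → ℕ} {M : Memory} (hM : C.LabelInv B M) {x v : ℕ} (hx : 2 ≤ x) :
    C.LabelInv B (M.setReg x v) := ⟨hM.1.setReg hx, hM.2, hM.3⟩

/-- The label of `i` cannot be decreased to that of `j`. -/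
def Relaxed (C : ChordSystem) (B : ℕ → ℕ) (i j : ℕ) (lab : ℕ → ℕ) : Prop :=
  i ∈ C.marked B → j ∈ C.marked B → C.Cross i j → lab i ≤ lab j

/-- The sum of the labels. -/
def labelSum (C : ChordSystem) (lab : ℕ → ℕ) : ℕ := ∑ i ∈ range C.m, lab i

theorem LabelInv.relax {B : ℕ → ℕ} {M : Memory} (hM : C.LabelInv B M) {i j : ℕ}
    (hi : i < C.m) (hj : j < C.m) (h2 : M.reg 2 = i) (h3 : M.reg 3 = j) :
    C.LabelInv B (Prog.relax.run M) ∧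
      ((C.Relaxed B i j (M.arr 4) ∧ (Prog.relax.run M).arr 4 = M.arr 4) ∨
        (¬ C.Relaxed B i j (M.arr 4) ∧
          C.labelSum ((Prog.relax.run M).arr 4) < C.labelSum (M.arr 4))) := by
  have hcond : 0 < ((Exp.load 5 (.var 2)).and ((Exp.load 5 (.var 3)).and ((Prog.cross 2 3).and
      ((Exp.load 4 (.var 3)).lt (.load 4 (.var 2)))))).eval M.arr M.reg ↔
      ¬ C.Relaxed B i j (M.arr 4) := by
    simp only [Exp.eval_and, Exp.eval_lt, hM.holds.eval_cross]
    simp only [Exp.eval, h2, h3, hM.arr_five, Relaxed, mem_marked, hi, hj, true_and, not_forall,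
      exists_prop, not_le]
  simp only [Prog.relax, Stmt.run]
  split_ifs with hpos
  · have hrel := hcond.1 hpos
    obtain ⟨hiB, hjB, hij, hlt⟩ : i ∈ C.marked B ∧ j ∈ C.marked B ∧ C.Cross i j ∧
        M.arr 4 j < M.arr 4 i := by
      simpa only [Relaxed, not_forall, exists_prop, not_le] using hrel
    have harr : (M.setArr 4 (Exp.eval M.arr (.var 2) M.reg)
        (Exp.eval M.arr (.load 4 (.var 3)) M.reg)).arr 4
        = Function.update (M.arr 4) i (M.arr 4 j) := by
      simp [Memory.setArr, Exp.eval, h2, h3]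
    refine ⟨⟨hM.1.of_keeps rfl rfl rfl rfl, hM.2, fun k hk => ?_⟩, Or.inr ⟨hrel, ?_⟩⟩
    · rw [harr]
      by_cases hki : k = i
      · subst hki
        rw [Function.update_self]
        exact (Conn.of_cross hiB hjB hij).trans (hM.3 j hjB)
      · rw [Function.update_of_ne hki]
        exact hM.3 k hk
    · rw [harr]
      refine sum_lt_sum (fun k _ => ?_) ⟨i, mem_range.2 hi, ?_⟩
      · by_cases hki : k = i
        · subst hki
          rw [Function.update_self]
          exact hlt.le
        · rw [Function.update_of_ne hki]
      · rwa [Function.update_self]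
  · exact ⟨hM, Or.inl ⟨by by_contra h; exact hpos (hcond.2 h), rfl⟩⟩

/-- After the labelling, every label names a member of the component, and crossing chords have the
same label. -/
theorem Holds.label_run {M : Memory} (hM : C.Holds M) :
    let F := C.marked (M.arr 5)
    let lab := (Prog.label.run M).arr 4
    (∀ i ∈ F, C.Conn F i (lab i)) ∧ ∀ i ∈ F, ∀ j ∈ F, (lab i = lab j ↔ C.Conn F i j) := by
  intro F lab
  let B := M.arr 5
  let T : Memory → Prop := fun a => ∀ i < C.m, ∀ j < C.m, C.Relaxed B i j (a.arr 4)
  have hpass : ∀ a, C.LabelInv B a →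
      C.LabelInv B ((Stmt.forBelow 2 1 (.forBelow 3 1 Prog.relax)).run a) ∧
      (((∀ i < C.m, ∀ j < C.m, C.Relaxed B i j (a.arr 4)) ∧
        ((Stmt.forBelow 2 1 (.forBelow 3 1 Prog.relax)).run a).arr 4 = a.arr 4) ∨
      (¬ (∀ i < C.m, ∀ j < C.m, C.Relaxed B i j (a.arr 4)) ∧
        C.labelSum (((Stmt.forBelow 2 1 (.forBelow 3 1 Prog.relax)).run a).arr 4) <
          C.labelSum (a.arr 4))) := by
    intro a ha
    have hm := ha.1.2
    simp only [Stmt.run]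
    rw [hm]
    refine iter_progress (Inv := C.LabelInv B) (fun a : Memory => a.arr 4) C.labelSum
      (fun i lab => ∀ j < C.m, C.Relaxed B i j lab) (fun i hi b hb => ?_) ha
    have hreg : (b.setReg 2 i).reg 1 = C.m := (hb.setReg (by omega)).1.2
    have := iter_progress (N := C.m) (Inv := fun c => C.LabelInv B c ∧ c.reg 2 = i)
      (fun a : Memory => a.arr 4) C.labelSum (fun j lab => C.Relaxed B i j lab)
      (f := fun j c => Prog.relax.run (c.setReg 3 j)) (fun j hj c hc => ?_)
      (a := b.setReg 2 i) ⟨hb.setReg (by omega), Memory.setReg_self _⟩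
    · rw [hreg]
      exact ⟨this.1.1, this.2⟩
    · have h1 := (hc.1.setReg (x := 3) (v := j) (by omega)).relax hi hj
        ((Memory.setReg_of_ne _ (by omega)).trans hc.2) (Memory.setReg_self _)
      refine ⟨⟨h1.1, ?_⟩, h1.2⟩
      have : Prog.relax.KeepsReg 2 := trivial
      rw [this.run_reg, Memory.setReg_of_ne _ (by omega), hc.2]
  have hpass' : ∀ a, C.LabelInv B a →
      C.LabelInv B ((Stmt.forBelow 2 1 (.forBelow 3 1 Prog.relax)).run a) ∧
      (T a → T ((Stmt.forBelow 2 1 (.forBelow 3 1 Prog.relax)).run a)) ∧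
      (T ((Stmt.forBelow 2 1 (.forBelow 3 1 Prog.relax)).run a) ∨
        C.labelSum (((Stmt.forBelow 2 1 (.forBelow 3 1 Prog.relax)).run a).arr 4) + 1 ≤
          C.labelSum (a.arr 4)) := by
    intro a ha
    obtain ⟨h1, h2⟩ := hpass a ha
    refine ⟨h1, ?_⟩
    rcases h2 with ⟨h2, h3⟩ | ⟨h2, h3⟩
    · have : T ((Stmt.forBelow 2 1 (.forBelow 3 1 Prog.relax)).run a) := by
        simp only [T]
        rw [h3]
        exact h2
      exact ⟨fun _ => this, Or.inl this⟩
    · exact ⟨fun h => absurd h h2, Or.inr h3⟩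
  let M₁ := (Prog.fill 4 (.var 2)).run M
  have hfill : ∀ i < C.m, M₁.arr 4 i = i := by
    have := Prog.fill_run (a := 4) (e := .var 2) (M := M) (fun i => i) fun i _ M' _ h => h
    rwa [hM.2] at this
  have hinit : C.LabelInv B M₁ := by
    refine ⟨hM.run (by simp [Prog.fill, Stmt.KeepsReg, Stmt.KeepsArr]), ?_, fun i hi => ?_⟩
    · have : (Prog.fill 4 (.var 2)).KeepsArr 5 := by simp [Prog.fill, Stmt.KeepsArr]
      exact this.run_arr M
    · rw [hfill i (mem_marked.1 hi).1]
      exact Conn.refl i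
  have hsum : C.labelSum (M₁.arr 4) < C.m * C.m := by
    have h1 : C.labelSum (M₁.arr 4) ≤ (range C.m).card • (C.m - 1) :=
      sum_le_card_nsmul _ _ _ fun i hi => by
        have := mem_range.1 hi
        rw [hfill i this]
        omega
    rw [card_range, smul_eq_mul] at h1
    exact h1.trans_lt (Nat.mul_lt_mul_of_pos_left (by have := C.m_pos; omega) C.m_pos)
  have hloop : C.LabelInv B (Prog.label.run M) ∧ (T M₁ → T (Prog.label.run M)) ∧
      (T (Prog.label.run M) ∨
        C.labelSum ((Prog.label.run M).arr 4) + C.m * C.m ≤ C.labelSum (M₁.arr 4)) := by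
    have hrun : Prog.label.run M =
        (Stmt.forBelow 8 1 (.forBelow 9 1 (.forBelow 2 1 (.forBelow 3 1 Prog.relax)))).run M₁ := rfl
    rw [hrun]
    generalize Stmt.forBelow 2 1 (.forBelow 3 1 Prog.relax) = pass at hpass'
    simp only [Stmt.run]
    rw [hinit.1.2]
    refine iter_fixpoint (Inv := C.LabelInv B) (T := T) (fun a : Memory => C.labelSum (a.arr 4))
      (fun p _ a ha => ?_) hinit
    have ha' := ha.setReg (x := 8) (v := p) (by omega)
    rw [ha'.1.2]
    have := iter_fixpoint (Inv := C.LabelInv B) (T := T) (N := C.m) (c := 1)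
      (f := fun i M => pass.run (M.setReg 9 i)) (fun a : Memory => C.labelSum (a.arr 4))
      (fun q _ b hb => hpass' _ (hb.setReg (by omega))) ha'
    rw [mul_one] at this
    exact this
  obtain ⟨h1, -, h2⟩ := hloop
  have hT : T (Prog.label.run M) := h2.resolve_right (by omega)
  refine ⟨h1.3, fun i hi j hj => ⟨fun h => ?_, fun h => ?_⟩⟩
  · have h3 := h1.3 j hj
    have h4 := h1.3 i hi
    change C.Conn F j (lab j) at h3
    rw [← h] at h3
    exact h4.trans h3.symm
  · clear hj
    induction h with
    | refl => rfl
    | @tail k l _ hkl ih =>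
      rw [ih]
      have hk := (mem_marked.1 hkl.1).1
      have hl := (mem_marked.1 hkl.2.1).1
      exact le_antisymm (hT k hk l hl hkl.1 hkl.2.1 hkl.2.2)
        (hT l hl k hk hkl.2.1 hkl.1 hkl.2.2.symm)

/-! #### Computing the potential -/

/-- Components are counted by the chords which carry their own index as label. -/
theorem numComp_eq_card_filter {F : Finset ℕ} {lab : ℕ → ℕ} (h1 : ∀ i ∈ F, C.Conn F i (lab i))
    (h2 : ∀ i ∈ F, ∀ j ∈ F, (lab i = lab j ↔ C.Conn F i j)) :
    C.numComp F = (F.filter fun i => lab i = i).card := by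
  have : F.image (C.comp F) = (F.filter fun i => lab i = i).image (C.comp F) := by
    refine Subset.antisymm (fun K hK => ?_) (image_subset_image (filter_subset _ _))
    obtain ⟨i, hi, rfl⟩ := mem_image.1 hK
    have hl := (h1 i hi).mem hi
    exact mem_image.2 ⟨lab i, mem_filter.2 ⟨hl, (h2 _ hl _ hi).2 (h1 i hi).symm⟩,
      (comp_eq_iff hi).2 (h1 i hi).symm⟩
  rw [numComp, this]
  refine card_image_of_injOn fun i hi j hj hij => ?_
  obtain ⟨hi, hi'⟩ := mem_filter.1 hi
  obtain ⟨hj, hj'⟩ := mem_filter.1 hj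
  rw [← hi', ← hj', (h2 i hi j hj).2 ((comp_eq_iff hj).1 hij)]

theorem Holds.potential_run {M : Memory} (hM : C.Holds M) :
    (Prog.potential.run M).reg 6 = C.potential (C.marked (M.arr 5)) := by
  obtain ⟨h1, h2⟩ := hM.label_run
  have hM' : C.Holds (Prog.label.run M) := hM.run (by
    simp [Prog.label, Prog.relax, Prog.fill, Stmt.KeepsReg, Stmt.KeepsArr])
  have h5 : (Prog.label.run M).arr 5 = M.arr 5 := by
    have : Prog.label.KeepsArr 5 := by simp [Prog.label, Prog.relax, Prog.fill, Stmt.KeepsArr]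
    exact this.run_arr M
  change ((Prog.label.run M).setReg 6 _).reg 6 = _
  rw [Memory.setReg_self]
  generalize Prog.label.run M = M' at *
  have hcount : ∀ (p : ℕ → Prop) [DecidablePred p] (n k : ℕ),
      ∑ i ∈ range n, (if p i then k else 0) = k * ((range n).filter p).card := by
    intro p _ n k
    rw [← sum_filter, sum_const, smul_eq_mul, mul_comm]
  have e1 : (Exp.sum 2 1 (.cond (.load 5 (.var 2)) (.const 7) (.const 0))).eval M'.arr M'.reg
      = 7 * (C.marked (M.arr 5)).card := by
    simp only [Exp.eval, Function.update_self, hM'.2, h5]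
    exact hcount _ _ _
  have e2 : (Exp.sum 4 0 (.cond (.sum 2 1 ((Exp.load 5 (.var 2)).and (Prog.hasEnd 2 (.var 4))))
      (.const 0) (.const 5))).eval M'.arr M'.reg = 5 * (C.uncovered (C.marked (M.arr 5))).card := by
    have : C.uncovered (C.marked (M.arr 5)) =
        (range C.n).filter fun v => ¬ v ∈ C.verts (C.marked (M.arr 5)) := by
      ext v
      simp [uncovered]
    rw [this, ← hcount, ← hM'.1]
    refine sum_congr rfl fun v _ => ?_
    have hiff : 0 < (Exp.sum 2 1 ((Exp.load 5 (.var 2)).and (Prog.hasEnd 2 (.var 4)))).eval M'.arr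
        (Function.update M'.reg 4 v) ↔ v ∈ C.verts (C.marked (M.arr 5)) := by
      rw [Exp.eval_sum, ChordSystem.mem_verts]
      simp only [Exp.eval_and, Prog.eval_hasEnd]
      simp [Exp.eval, hM'.2, hM'.3, hM'.4, h5, mem_marked, and_assoc]
    change (if 0 < Exp.eval M'.arr (Exp.sum 2 1 _) _ then 0 else 5) = _
    rw [ite_not]
    exact if_congr hiff rfl rfl
  have e3 : (Exp.sum 2 1 (.cond ((Exp.load 5 (.var 2)).and ((Exp.load 4 (.var 2)).eq (.var 2)))
      (.const 15) (.const 0))).eval M'.arr M'.reg = 15 * C.numComp (C.marked (M.arr 5)) := by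
    rw [numComp_eq_card_filter h1 h2, marked, filter_filter, ← hcount, ← hM'.2]
    refine sum_congr rfl fun i _ => ?_
    rw [Exp.eval]
    simp only [Exp.eval_and, Exp.eval_eq]
    simp only [Exp.eval, Function.update_self, h5]
  change Exp.eval _ ((Exp.add _ _).add _) _ = _
  rw [Exp.eval, Exp.eval, e1, e2, e3]
  rfl

/-! #### The local search -/

/-- No extension of `W` by a tuple of `j` chords decreases the potential when it is added to `F`. -/
def NoGain (C : ChordSystem) : ℕ → Finset ℕ → Finset ℕ → Prop
  | 0, F, W => C.potential F ≤ C.potential (F ∪ W)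
  | j + 1, F, W => ∀ x < C.m, NoGain C j F (insert x W)

/-- Tuples may repeat chords, so that those of length `j` represent all nonempty sets of at most
`j` chords. -/
theorem NoGain.le {j : ℕ} {F W : Finset ℕ} (h : C.NoGain j F W) {A : Finset ℕ}
    (hA : A ⊆ range C.m) (hne : j = 0 ∨ A.Nonempty) (hcard : A.card ≤ j) :
    C.potential F ≤ C.potential (F ∪ (W ∪ A)) := by
  induction j generalizing W A with
  | zero =>
    have : A = ∅ := card_eq_zero.1 (by omega)
    rw [this, union_empty]
    exact h
  | succ j ih =>
    obtain ⟨x, hx⟩ := hne.resolve_left (by omega)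
    have hxm := h x (mem_range.1 (hA hx))
    by_cases he : j = 0 ∨ (A.erase x).Nonempty
    · have := ih hxm ((erase_subset x A).trans hA) he
        (by rw [card_erase_of_mem hx]; omega)
      rwa [insert_union, ← union_insert, insert_erase hx] at this
    · -- `A = {x}`: the remaining members of the tuple repeat `x`
      rw [not_or, not_nonempty_iff_eq_empty] at he
      have := ih hxm hA (Or.inr ⟨x, hx⟩) (by
        have := card_erase_of_mem hx
        rw [he.2, card_empty] at this
        omega)
      rwa [insert_union, ← union_insert, insert_eq_self.2 hx] at this

theorem NoGain.isLocalOpt {k : ℕ} {F : Finset ℕ} (h : C.NoGain k F ∅) : C.IsLocalOpt k F := by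
  intro A hA hne hk
  have := h.le hA (Or.inr hne) hk
  rwa [empty_union] at this

/-- The invariant of the local search; array `3` holds the tuple under trial. -/
structure SearchInv (C : ChordSystem) (w : ℕ → ℕ) (M : Memory) : Prop where
  holds : C.Holds M
  arr_three : M.arr 3 = w
  zero_mem : 0 ∈ C.marked (M.arr 2)
  potential_le : C.potential (C.marked (M.arr 2)) ≤ 5 * C.n + 12

theorem SearchInv.setReg {w : ℕ → ℕ} {M : Memory} (hM : C.SearchInv w M) {x v : ℕ} (hx : 2 ≤ x) :
    C.SearchInv w (M.setReg x v) := ⟨hM.1.setReg hx, hM.2, hM.3, hM.4⟩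

/-- The number of chords which are not selected. -/
def slack (C : ChordSystem) (F : Finset ℕ) : ℕ := C.m - F.card

theorem slack_lt {F G : Finset ℕ} (h : F ⊂ G) (hG : G ⊆ range C.m) : C.slack G < C.slack F := by
  have h1 := card_lt_card h
  have h2 := card_le_card hG
  rw [card_range] at h2
  unfold slack
  omega

theorem Holds.fill {M : Memory} (hM : C.Holds M) {a : ℕ} (ha : 2 ≤ a) {e : Exp} :
    C.Holds ((Prog.fill a e).run M) :=
  hM.run (by simp [Prog.fill, Stmt.KeepsReg, Stmt.KeepsArr]; omega)

theorem Holds.potential {M : Memory} (hM : C.Holds M) : C.Holds (Prog.potential.run M) :=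
  hM.run (by simp [Prog.potential, Prog.label, Prog.relax, Prog.fill, Stmt.KeepsReg,
    Stmt.KeepsArr])

theorem potential_keepsArr {a : ℕ} (ha : a ≠ 4) : Prog.potential.KeepsArr a := by
  simp [Prog.potential, Prog.label, Prog.relax, Prog.fill, Stmt.KeepsArr, ha]

theorem fill_keepsArr {a b : ℕ} {e : Exp} (hb : b ≠ a) : (Prog.fill a e).KeepsArr b := hb

/-- The test of one tuple either fails, and nothing changes, or it succeeds, and new chords are
selected. -/
theorem SearchInv.check {w : ℕ → ℕ} {M : Memory} (hM : C.SearchInv w M) :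
    C.SearchInv w (Prog.check.run M) ∧
      ((C.NoGain 0 (C.marked (M.arr 2)) (C.marked w) ∧
          C.marked ((Prog.check.run M).arr 2) = C.marked (M.arr 2)) ∨
        (¬ C.NoGain 0 (C.marked (M.arr 2)) (C.marked w) ∧
          C.slack (C.marked ((Prog.check.run M).arr 2)) < C.slack (C.marked (M.arr 2)))) := by
  obtain ⟨M₁, hM₁⟩ : ∃ M₁, M₁ = (Prog.fill 5 (.load 2 (.var 2))).run M := ⟨_, rfl⟩
  obtain ⟨M₂, hM₂⟩ : ∃ M₂, M₂ = Prog.potential.run M₁ := ⟨_, rfl⟩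
  obtain ⟨M₃, hM₃⟩ : ∃ M₃, M₃ = M₂.setReg 7 (M₂.reg 6) := ⟨_, rfl⟩
  obtain ⟨M₄, hM₄⟩ : ∃ M₄, M₄ =
    (Prog.fill 5 ((Exp.load 2 (.var 2)).add (.load 3 (.var 2)))).run M₃ := ⟨_, rfl⟩
  obtain ⟨M₅, hM₅⟩ : ∃ M₅, M₅ = Prog.potential.run M₄ := ⟨_, rfl⟩
  have hrun : Prog.check.run M =
      if 0 < ((Exp.var 6).lt (.var 7)).eval M₅.arr M₅.reg then
        (Prog.fill 2 (.load 5 (.var 2))).run M₅ else M₅ := by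
    subst hM₁ hM₂ hM₃ hM₄ hM₅
    rfl
  have h1 : C.Holds M₁ := hM₁ ▸ hM.1.fill (by omega)
  have h2 : C.Holds M₂ := hM₂ ▸ h1.potential
  have h3 : C.Holds M₃ := hM₃ ▸ h2.setReg (by omega)
  have h4 : C.Holds M₄ := hM₄ ▸ h3.fill (by omega)
  have h5 : C.Holds M₅ := hM₅ ▸ h4.potential
  have ha3 : ∀ b, b ≠ 4 → b ≠ 5 → M₃.arr b = M.arr b := by
    intro b hb4 hb5
    rw [hM₃]
    change M₂.arr b = _
    rw [hM₂, (potential_keepsArr hb4).run_arr, hM₁, (fill_keepsArr hb5).run_arr]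
  have ha5 : ∀ b, b ≠ 4 → b ≠ 5 → M₅.arr b = M.arr b := by
    intro b hb4 hb5
    rw [hM₅, (potential_keepsArr hb4).run_arr, hM₄, (fill_keepsArr hb5).run_arr, ha3 b hb4 hb5]
  have hm1 : C.marked (M₁.arr 5) = C.marked (M.arr 2) := by
    refine marked_congr ?_
    rw [hM₁, ← hM.1.2]
    refine Prog.fill_run _ fun i _ M' hM' hi => ?_
    simp only [Exp.eval, hi]
    rw [hM' 2 (by omega)]
  have hm4 : ∀ i < C.m, M₄.arr 5 i = M.arr 2 i + w i := by
    rw [hM₄, ← h3.2]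
    refine Prog.fill_run _ fun i _ M' hM' hi => ?_
    simp only [Exp.eval, hi]
    rw [hM' 2 (by omega), hM' 3 (by omega), ha3 2 (by omega) (by omega),
      ha3 3 (by omega) (by omega), hM.2]
  have hm4' : C.marked (M₄.arr 5) = C.marked (M.arr 2) ∪ C.marked w := by
    rw [marked_congr hm4]
    ext i
    rw [mem_union, mem_marked, mem_marked, mem_marked]
    have : 0 < M.arr 2 i + w i ↔ 0 < M.arr 2 i ∨ 0 < w i := by omega
    rw [this, and_or_left]
  have hp7 : M₅.reg 7 = C.potential (C.marked (M.arr 2)) := by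
    have hk : Prog.potential.KeepsReg 7 := by
      simp [Prog.potential, Prog.label, Prog.relax, Prog.fill, Stmt.KeepsReg]
    have hk' : (Prog.fill 5 ((Exp.load 2 (.var 2)).add (.load 3 (.var 2)))).KeepsReg 7 := by
      simp [Prog.fill, Stmt.KeepsReg]
    rw [hM₅, hk.run_reg, hM₄, hk'.run_reg, hM₃, Memory.setReg_self, hM₂, h1.potential_run, hm1]
  have hp6 : M₅.reg 6 = C.potential (C.marked (M.arr 2) ∪ C.marked w) := by
    rw [hM₅, h4.potential_run, hm4']
  have hcond : 0 < ((Exp.var 6).lt (.var 7)).eval M₅.arr M₅.reg ↔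
      ¬ C.NoGain 0 (C.marked (M.arr 2)) (C.marked w) := by
    rw [Exp.eval_lt]
    simp only [Exp.eval, hp6, hp7, NoGain, not_le]
  rw [hrun]
  split_ifs with hpos
  · have hgain := hcond.1 hpos
    have hgain' := hgain
    rw [NoGain, not_le] at hgain'
    have hm5 : C.marked (((Prog.fill 2 (.load 5 (.var 2))).run M₅).arr 2) =
        C.marked (M.arr 2) ∪ C.marked w := by
      rw [← hm4']
      refine marked_congr ?_
      rw [← h5.2]
      refine Prog.fill_run _ fun i _ M' hM' hi => ?_
      simp only [Exp.eval, hi]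
      rw [hM' 5 (by omega), hM₅, (potential_keepsArr (by omega)).run_arr]
    refine ⟨⟨h5.fill (by omega), ?_, ?_, ?_⟩, Or.inr ⟨hgain, ?_⟩⟩
    · rw [(fill_keepsArr (by omega)).run_arr, ha5 3 (by omega) (by omega), hM.2]
    · rw [hm5]
      exact mem_union_left _ hM.3
    · rw [hm5]
      exact hgain'.le.trans hM.4
    · rw [hm5]
      refine slack_lt ⟨subset_union_left, fun h => ?_⟩
        (union_subset (marked_subset _) (marked_subset _))
      rw [Subset.antisymm h subset_union_left] at hgain'
      exact lt_irrefl _ hgain'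
  · have h2' := ha5 2 (by omega) (by omega)
    refine ⟨⟨h5, (ha5 3 (by omega) (by omega)).trans hM.2, ?_, ?_⟩,
      Or.inl ⟨by by_contra h; exact hpos (hcond.2 h), ?_⟩⟩
    · rw [h2']; exact hM.3
    · rw [h2']; exact hM.4
    · rw [h2']

/-- A search either finds no improvement, and nothing changes, or it selects new chords. -/
theorem SearchInv.search {j : ℕ} : ∀ {w : ℕ → ℕ} {M : Memory}, C.SearchInv w M →
    C.SearchInv w ((Prog.search j).run M) ∧
      ((C.NoGain j (C.marked (M.arr 2)) (C.marked w) ∧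
          C.marked (((Prog.search j).run M).arr 2) = C.marked (M.arr 2)) ∨
        (¬ C.NoGain j (C.marked (M.arr 2)) (C.marked w) ∧
          C.slack (C.marked (((Prog.search j).run M).arr 2)) < C.slack (C.marked (M.arr 2)))) := by
  induction j with
  | zero =>
    intro w M hM
    rw [Prog.search]
    exact hM.check
  | succ j ih =>
    intro w M hM
    simp only [Prog.search]
    rw [Stmt.run, hM.1.2]
    refine iter_progress (Inv := C.SearchInv w) (fun a : Memory => C.marked (a.arr 2)) C.slack
      (fun x F => C.NoGain j F (insert x (C.marked w))) (fun x hx a ha => ?_) hM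
    let w' := Function.update w x (w x + 1)
    have hw' : C.marked w' = insert x (C.marked w) := by
      ext i
      rw [mem_insert, mem_marked, mem_marked]
      by_cases hi : i = x
      · subst hi
        simp [w', hx]
      · simp [w', hi]
    have ha1 := ha.setReg (x := 11 + j) (v := x) (by omega)
    obtain ⟨a₂, ha₂⟩ : ∃ a₂, a₂ = (a.setReg (11 + j) x).setArr 3 x (w x + 1) := ⟨_, rfl⟩
    obtain ⟨a₃, ha₃⟩ : ∃ a₃, a₃ = (Prog.search j).run a₂ := ⟨_, rfl⟩
    have h2 : C.SearchInv w' a₂ := by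
      have hw : a₂.arr 3 = w' := by
        rw [ha₂, Memory.setArr_self]
        change Function.update (a.arr 3) x (w x + 1) = _
        rw [ha.2]
      have h2 : a₂.arr 2 = a.arr 2 := by
        rw [ha₂]
        rfl
      exact ⟨ha₂ ▸ ha1.1.of_keeps rfl rfl rfl rfl, hw, h2 ▸ ha.3, h2 ▸ ha.4⟩
    have hreg : a₃.reg (11 + j) = x := by
      rw [ha₃, (Prog.search_keepsReg j (11 + j) (Or.inl le_rfl)).run_reg, ha₂]
      exact Memory.setReg_self _
    obtain ⟨h3, h4⟩ := ih h2
    rw [← ha₃] at h3 h4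
    have hrun : (Stmt.seq (.store 3 (.var (11 + j)) ((Exp.load 3 (.var (11 + j))).add (.const 1)))
        (.seq (Prog.search j)
          (.store 3 (.var (11 + j)) ((Exp.load 3 (.var (11 + j))).sub (.const 1))))).run
            (a.setReg (11 + j) x) = a₃.setArr 3 x (w x) := by
      have e1 : (Stmt.store 3 (.var (11 + j)) ((Exp.load 3 (.var (11 + j))).add (.const 1))).run
          (a.setReg (11 + j) x) = a₂ := by
        rw [ha₂]
        simp only [Stmt.run, Exp.eval, Memory.setReg_self]
        change Memory.setArr _ 3 x (a.arr 3 x + 1) = _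
        rw [ha.2]
      have e2 : (Stmt.store 3 (.var (11 + j)) ((Exp.load 3 (.var (11 + j))).sub (.const 1))).run a₃
          = a₃.setArr 3 x (w x) := by
        simp only [Stmt.run, Exp.eval, hreg, h3.2, w', Function.update_self, Nat.add_sub_cancel]
      change (Stmt.store _ _ _).run ((Prog.search j).run ((Stmt.store _ _ _).run _)) = _
      rw [e1, ← ha₃, e2]
    have hmark : C.marked (a₂.arr 2) = C.marked (a.arr 2) := by
      rw [ha₂]
      rfl
    rw [hw', hmark] at h4
    rw [hrun]
    refine ⟨⟨h3.1.of_keeps rfl rfl rfl rfl, ?_, h3.3, h3.4⟩, h4⟩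
    rw [Memory.setArr_self, h3.2]
    simp [w']

/-- The search ends in a local optimum. -/
theorem SearchInv.search_loop {k : ℕ} {M : Memory} (hM : C.SearchInv (fun _ => 0) M) :
    C.SearchInv (fun _ => 0) ((Stmt.forBelow 10 1 (Prog.search k)).run M) ∧
      C.IsLocalOpt k (C.marked (((Stmt.forBelow 10 1 (Prog.search k)).run M).arr 2)) := by
  have hw : C.marked (fun _ => 0) = ∅ := by simp [marked]
  have := iter_fixpoint (N := C.m) (c := 1) (Inv := C.SearchInv fun _ => 0)
    (T := fun a : Memory => C.NoGain k (C.marked (a.arr 2)) ∅)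
    (f := fun i M => (Prog.search k).run (M.setReg 10 i))
    (fun a : Memory => C.slack (C.marked (a.arr 2))) (fun i _ a ha => ?_) hM
  · have h1 : (Stmt.forBelow 10 1 (Prog.search k)).run M
        = iter (fun i M => (Prog.search k).run (M.setReg 10 i)) C.m M := by
      rw [Stmt.run, hM.1.2]
    rw [h1]
    refine ⟨this.1, NoGain.isLocalOpt (this.2.2.resolve_right fun h => ?_)⟩
    have h2 := card_pos.2 ⟨0, hM.3⟩
    have h3 := C.m_pos
    unfold slack at h
    omega
  · obtain ⟨h1, h2⟩ := (ha.setReg (x := 10) (v := i) (by omega)).search (j := k)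
    refine ⟨h1, ?_⟩
    rw [hw] at h2
    rcases h2 with ⟨h2, h3⟩ | ⟨h2, h3⟩
    · simp only [h3]
      exact ⟨fun h => h, Or.inl h2⟩
    · exact ⟨fun h => absurd h h2, Or.inr h3⟩

/-! #### The completion -/

/-- The invariant of the completion of `F`: every added chord has been paid for by the defect. -/
structure ExtendInv (C : ChordSystem) (F : Finset ℕ) (M : Memory) : Prop where
  holds : C.Holds M
  subset : F ⊆ C.marked (M.arr 2)
  card_le : (C.marked (M.arr 2)).card + C.defect F (C.comp (C.marked (M.arr 2)) 0) ≤
    F.card + C.defect F (C.comp F 0)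

theorem ExtendInv.setReg {F : Finset ℕ} {M : Memory} (hM : C.ExtendInv F M) {x v : ℕ}
    (hx : 2 ≤ x) : C.ExtendInv F (M.setReg x v) := ⟨hM.1.setReg hx, hM.2, hM.3⟩

/-- The chord in register `5` is selected if and only if it extends the component of chord `0`. -/
theorem ExtendInv.extend {F : Finset ℕ} (hF : 0 ∈ F) {M : Memory} (hM : C.ExtendInv F M) {x : ℕ}
    (hx : x < C.m) (hx5 : M.reg 5 = x) :
    C.ExtendInv F (Prog.extend.run M) ∧
      ((¬ C.Extends (C.marked (M.arr 2)) 0 x ∧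
          C.marked ((Prog.extend.run M).arr 2) = C.marked (M.arr 2)) ∨
        (¬ ¬ C.Extends (C.marked (M.arr 2)) 0 x ∧
          C.slack (C.marked ((Prog.extend.run M).arr 2)) < C.slack (C.marked (M.arr 2)))) := by
  obtain ⟨M₁, hM₁⟩ : ∃ M₁, M₁ = (Prog.fill 5 (.load 2 (.var 2))).run M := ⟨_, rfl⟩
  obtain ⟨M₂, hM₂⟩ : ∃ M₂, M₂ = Prog.label.run M₁ := ⟨_, rfl⟩
  have hrun : Prog.extend.run M =
      if 0 < Prog.extendsExp.eval M₂.arr M₂.reg then M₂.setArr 2 (M₂.reg 5) 1 else M₂ := by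
    subst hM₁ hM₂
    rfl
  have h1 : C.Holds M₁ := hM₁ ▸ hM.1.fill (by omega)
  have h2 : C.Holds M₂ := hM₂ ▸ h1.run (by
    simp [Prog.label, Prog.relax, Prog.fill, Stmt.KeepsReg, Stmt.KeepsArr])
  have hk : ∀ b, b ≠ 4 → Prog.label.KeepsArr b := by
    intro b hb
    simp [Prog.label, Prog.relax, Prog.fill, Stmt.KeepsArr, hb]
  have hm1 : C.marked (M₁.arr 5) = C.marked (M.arr 2) := by
    refine marked_congr ?_
    rw [hM₁, ← hM.1.2]
    refine Prog.fill_run _ fun i _ M' hM' hi => ?_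
    simp only [Exp.eval, hi]
    rw [hM' 2 (by omega)]
  have ha2 : M₂.arr 2 = M.arr 2 := by
    rw [hM₂, (hk 2 (by omega)).run_arr, hM₁, (fill_keepsArr (by omega)).run_arr]
  have ha5 : M₂.arr 5 = M₁.arr 5 := by
    rw [hM₂, (hk 5 (by omega)).run_arr]
  have hr5 : M₂.reg 5 = x := by
    have hk5 : Prog.label.KeepsReg 5 := by
      simp [Prog.label, Prog.relax, Prog.fill, Stmt.KeepsReg]
    have hk5' : (Prog.fill 5 (.load 2 (.var 2))).KeepsReg 5 := by
      simp [Prog.fill, Stmt.KeepsReg]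
    rw [hM₂, hk5.run_reg, hM₁, hk5'.run_reg, hx5]
  obtain ⟨-, hlab⟩ := h1.label_run
  rw [← hM₂, hm1] at hlab
  have h0 : 0 ∈ C.marked (M.arr 2) := hM.2 hF
  have hcomp : ∀ i, i ∈ C.comp (C.marked (M.arr 2)) 0 ↔
      i < C.m ∧ 0 < M₂.arr 5 i ∧ M₂.arr 4 i = M₂.arr 4 0 := by
    intro i
    rw [mem_comp, ← and_assoc, ha5, ← mem_marked, hm1]
    refine and_congr_right fun hi => ?_
    rw [← hlab 0 h0 i hi, eq_comm]
  have hinMain : ∀ i, 0 < (Prog.inMain 3).eval M₂.arr (Function.update M₂.reg 3 i) ↔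
      0 < M₂.arr 5 i ∧ M₂.arr 4 i = M₂.arr 4 0 := by
    intro i
    simp only [Prog.inMain, Exp.eval_and, Exp.eval_eq]
    simp only [Exp.eval, Function.update_self]
  have hverts : ∀ v : Exp, ∀ y : ℕ,
      (∀ i, v.eval M₂.arr (Function.update M₂.reg 3 i) = y) →
      (0 < (Exp.sum 3 1 ((Prog.inMain 3).and (Prog.hasEnd 3 v))).eval M₂.arr M₂.reg ↔
        y ∈ C.verts (C.comp (C.marked (M.arr 2)) 0)) := by
    intro v y hv
    rw [Exp.eval_sum, ChordSystem.mem_verts, h2.2]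
    simp only [Exp.eval_and, Prog.eval_hasEnd, hinMain, hcomp, hv, Function.update_self, h2.3, h2.4,
      and_assoc]
  have hcond : 0 < Prog.extendsExp.eval M₂.arr M₂.reg ↔
      C.Extends (C.marked (M.arr 2)) 0 x := by
    have e1 := hverts (.load 0 (.var 5)) (C.L x) fun i => by simp [Exp.eval, hr5, h2.3]
    have e2 := hverts (.load 1 (.var 5)) (C.R x) fun i => by simp [Exp.eval, hr5, h2.4]
    have e3 : 0 < (Exp.sum 3 1 ((Prog.inMain 3).and (Prog.cross 5 3))).eval M₂.arr M₂.reg ↔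
        ∃ j ∈ C.comp (C.marked (M.arr 2)) 0, C.Cross x j := by
      have h53 : ∀ i, Function.update M₂.reg 3 i 5 = x := fun i =>
        (Function.update_of_ne (by omega) _ _).trans hr5
      rw [Exp.eval_sum, h2.2]
      simp only [Exp.eval_and, hinMain, hcomp, h2.eval_cross, Function.update_self, h53, and_assoc]
    rw [Prog.extendsExp, Exp.eval_and, Exp.eval_or, Exp.eval_not, Exp.eval_not, e1, e2, e3]
    rfl
  rw [hrun]
  split_ifs with hpos
  · have hext := hcond.1 hpos
    have hnm := hext.notMem
    have hins : C.marked ((M₂.setArr 2 (M₂.reg 5) 1).arr 2) = insert x (C.marked (M.arr 2)) := by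
      have : (M₂.setArr 2 (M₂.reg 5) 1).arr 2 = Function.update (M.arr 2) x 1 := by
        rw [hr5, ← ha2]
        exact Memory.setArr_self _
      rw [this]
      ext i
      rw [mem_insert, mem_marked, mem_marked]
      by_cases hi : i = x
      · subst hi
        simp [hx]
      · simp [hi]
    refine ⟨⟨h2.of_keeps rfl rfl rfl rfl, ?_, ?_⟩, Or.inr ⟨not_not.2 hext, ?_⟩⟩
    · rw [hins]
      exact hM.2.trans (subset_insert _ _)
    · rw [hins, card_insert_of_notMem hnm]
      have h3 := hext.defect_lt hM.2 h0 hx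
      have h4 := hM.3
      omega
    · rw [hins]
      exact slack_lt (ssubset_insert hnm)
        (insert_subset (mem_range.2 hx) (marked_subset _))
  · refine ⟨⟨h2, ?_, ?_⟩, Or.inl ⟨fun h => hpos (hcond.2 h), ?_⟩⟩
    · rw [ha2]; exact hM.2
    · rw [ha2]; exact hM.3
    · rw [ha2]

/-- The completion ends when no chord extends the component of chord `0`. -/
theorem ExtendInv.extend_loop {F : Finset ℕ} (hF : 0 ∈ F) {M : Memory} (hM : C.ExtendInv F M) :
    C.ExtendInv F ((Stmt.forBelow 10 1 (.forBelow 5 1 Prog.extend)).run M) ∧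
      ∀ x < C.m, ¬ C.Extends
        (C.marked (((Stmt.forBelow 10 1 (.forBelow 5 1 Prog.extend)).run M).arr 2)) 0 x := by
  have hpass : ∀ a, C.ExtendInv F a → _ := fun a ha =>
    iter_progress (N := C.m) (Inv := C.ExtendInv F)
      (f := fun i M => Prog.extend.run (M.setReg 5 i))
      (fun a : Memory => C.marked (a.arr 2)) C.slack (fun x G => ¬ C.Extends G 0 x)
      (fun x hx a ha => (ha.setReg (x := 5) (v := x) (by omega)).extend hF hx
        (Memory.setReg_self _)) ha
  have := iter_fixpoint (N := C.m) (c := 1) (Inv := C.ExtendInv F)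
    (T := fun a : Memory => ∀ x < C.m, ¬ C.Extends (C.marked (a.arr 2)) 0 x)
    (f := fun i M => (Stmt.forBelow 5 1 Prog.extend).run (M.setReg 10 i))
    (fun a : Memory => C.slack (C.marked (a.arr 2))) (fun i _ a ha => ?_) hM
  · have h1 : (Stmt.forBelow 10 1 (.forBelow 5 1 Prog.extend)).run M
        = iter (fun i M => (Stmt.forBelow 5 1 Prog.extend).run (M.setReg 10 i)) C.m M := by
      rw [Stmt.run, hM.1.2]
    rw [h1]
    refine ⟨this.1, this.2.2.resolve_right fun h => ?_⟩
    have h2 := card_pos.2 ⟨0, hM.2 hF⟩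
    have h3 := C.m_pos
    unfold slack at h
    omega
  · have ha' := ha.setReg (x := 10) (v := i) (by omega)
    have h1 : (Stmt.forBelow 5 1 Prog.extend).run (a.setReg 10 i)
        = iter (fun i M => Prog.extend.run (M.setReg 5 i)) C.m (a.setReg 10 i) := by
      rw [Stmt.run, ha'.1.2]
    obtain ⟨h2, h3⟩ := hpass _ ha'
    simp only [h1]
    refine ⟨h2, ?_⟩
    rcases h3 with ⟨h3, h4⟩ | ⟨h3, h4⟩
    · simp only [h4]
      exact ⟨fun h => h, Or.inl h3⟩
    · exact ⟨fun h => absurd h h3, Or.inr h4⟩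

theorem potential_singleton_le {i : ℕ} (hi : i < C.m) : C.potential {i} ≤ 5 * C.n + 12 := by
  have h1 : C.numComp {i} = 1 := by simp [numComp]
  have h2 : (C.verts {i}).card = 2 := by
    have := C.chord i hi
    simp only [verts, image_singleton]
    exact card_pair (by unfold IsCut at this; omega)
  have h3 : (C.uncovered {i}).card + 2 = C.n := by
    rw [← h2, uncovered, card_sdiff_add_card_eq_card, card_range]
    exact fun v hv => mem_range.2
      (lt_of_mem_verts (singleton_subset_iff.2 (mem_range.2 hi)) hv)
  unfold potential
  rw [h1, card_singleton]
  omega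

/-- The effect of the whole program: the selected chords are feasible, and at most `1.8704` times
as many as those of any feasible set. -/
theorem Holds.main_run {M : Memory} (hM : C.Holds M) (h2 : M.arr 2 = fun _ => 0)
    (h3 : M.arr 3 = fun _ => 0) :
    C.Feasible (C.marked (((Prog.main 80).run M).arr 2)) ∧
      ∀ T ⊆ range C.m, C.Feasible T →
        10000 * (C.marked (((Prog.main 80).run M).arr 2)).card ≤ 18704 * T.card := by
  obtain ⟨M₁, hM₁⟩ : ∃ M₁, M₁ = M.setArr 2 0 1 := ⟨_, rfl⟩
  obtain ⟨M₂, hM₂⟩ : ∃ M₂, M₂ = (Stmt.forBelow 10 1 (Prog.search 80)).run M₁ := ⟨_, rfl⟩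
  have hrun : (Prog.main 80).run M = (Stmt.forBelow 10 1 (.forBelow 5 1 Prog.extend)).run M₂ := by
    subst hM₁ hM₂
    rfl
  have hmark : C.marked (M₁.arr 2) = {0} := by
    have : M₁.arr 2 = Function.update (fun _ => 0) 0 1 := by
      rw [hM₁, Memory.setArr_self, h2]
    rw [this]
    ext i
    rw [mem_marked, mem_singleton]
    by_cases hi : i = 0
    · subst hi
      simp [C.m_pos]
    · simp [hi]
  have hinv : C.SearchInv (fun _ => 0) M₁ := by
    refine ⟨hM₁ ▸ hM.of_keeps rfl rfl rfl rfl, hM₁ ▸ h3, ?_, ?_⟩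
    · rw [hmark]
      exact mem_singleton_self 0
    · rw [hmark]
      exact potential_singleton_le C.m_pos
  obtain ⟨h4, h5⟩ := hinv.search_loop (k := 80)
  rw [← hM₂] at h4 h5
  have hinv' : C.ExtendInv (C.marked (M₂.arr 2)) M₂ := ⟨h4.1, Subset.refl _, le_rfl⟩
  obtain ⟨h6, h7⟩ := hinv'.extend_loop h4.3
  rw [← hrun] at h6 h7
  refine ⟨feasible_of_forall_not_extends (marked_subset _) (h6.2 h4.3) h7, fun T hTm hT => ?_⟩
  exact card_le_of_isLocalOpt h5 (marked_subset _) h4.3 h4.4 (le_trans (Nat.le_add_right _ _) h6.3)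
    hT hTm

end ChordSystem

end CycleVCA

theorem theorem1 :
    ∃ P : RAM.Program, CycleVCA.IsPolyTimeApproximation (1.8704 : ℝ) P := by
  refine ⟨(CycleVCA.Prog.main 80).compile 91,
    (CycleVCA.Prog.main 80).cost.comp (Polynomial.X ^ 2), fun n S l hS hl => ?_⟩
  let C := hS.chordSystem hl
  -- the running time is polynomial in `n` and in the number of links, which is at most `n ^ 2`
  have hlen : l.length ≤ n ^ 2 := by
    have h1 : l.Nodup := hl.1.of_map
    have h2 := h1.length_le_card
    rw [Fintype.card_prod, Fintype.card_fin] at h2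
    rw [pow_two]
    exact h2
  have hn : n ≤ n ^ 2 := Nat.le_self_pow (by norm_num) n
  have hin : C.Holds (CycleVCA.input n l) := by
    refine ⟨rfl, rfl, ?_, ?_⟩ <;> funext i <;>
      simp [CycleVCA.input, C, CycleVCA.IsInstance.chordSystem]
  obtain ⟨M, t, hrun, ht, -, harr, -⟩ := RAM.Stmt.compile_runs (by norm_num)
    (CycleVCA.Prog.main_ok 80) (d := 91) le_rfl (N := n ^ 2) (M₀ := CycleVCA.input n l)
    (M := CycleVCA.input n l) hn hlen (fun _ _ => rfl) rfl
  obtain ⟨h1, h2⟩ := hin.main_run (by funext i; simp [CycleVCA.input])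
    (by funext i; simp [CycleVCA.input])
  rw [← harr] at h1 h2
  have hout := hS.isFeasible_output hl (M := M)
    (I := C.marked (M.arr 2)) (fun i hi => by
      rw [CycleVCA.ChordSystem.mem_marked]
      exact ⟨fun h => ⟨hi, Nat.pos_of_ne_zero h⟩, fun h => h.2.ne'⟩)
    (CycleVCA.ChordSystem.marked_subset _) h1
  refine ⟨M, t, hrun, ?_, hout.1, fun T' hT' => ?_⟩
  · rw [Polynomial.eval_comp, Polynomial.eval_pow, Polynomial.eval_X]
    exact ht
  · obtain ⟨I, hIm, hI, hcard⟩ := hS.exists_feasible hl hT'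
    have h3 : 10000 * (CycleVCA.output l M).card ≤ 18704 * T'.card :=
      (Nat.mul_le_mul_left _ hout.2).trans ((h2 I hIm hI).trans (Nat.mul_le_mul_left _ hcard))
    have h4 : (10000 : ℝ) * (CycleVCA.output l M).card ≤ 18704 * T'.card := by exact_mod_cast h3
    linarith
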